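/- Let $d\ge 1$, let $(M_1,g_1)$ and $(M_2,g_2)$ be smooth (Hausdorff, second countable) oriented $d$-dimensional Riemannian manifolds, possibly with boundary, and let $f:M_1\to M_2$ be smooth. For oriented $d$-dimensional inner product spaces $V,W$ with Hodge duals $\star^k:\Lambda_k\to\Lambda_{d-k}$ and a linear map $A:V\to W$, put $\operatorname{Det}A=\star_W^d\circ\Lambda^dA\circ\star_V^0\in\mathbb R$ and $\operatorname{Cof}A=(-1)^{d-1}\star_W^{d-1}\circ\Lambda^{d-1}A\circ\star_V^1\in\operatorname{Hom}(V,W)$. Applied to $df_p:T_pM_1\to T_{f(p)}M_2$, this gives the function $\operatorname{Det}df$ and the $f^*TM_2$-valued one-form $\operatorname{Cof}df$ on $M_1$. For a smooth vector field $X$ on $M_2$ let $f^*X=X\circ f$, a section of $f^*TM_2$, and let $\operatorname{Piola}(X)=(\operatorname{Cof}df)^T(f^*X)$, a vector field on $M_1$. Let $\operatorname{div}X=\operatorname{tr}\nabla X$ with $\nabla$ the Levi-Civita connection, and let $\nabla^{f^*TM_2}$ be the connection on $f^*TM_2$ induced by the Levi-Civita connection of $M_2$. The coderivative $\delta_{\nabla^{f^*TM_2}}\omega$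 of an $f^*TM_2$-valued one-form $\omega$ is the smooth section of $f^*TM_2$ with $$\int_{M_1}\langle\sigma,\delta_{\nabla^{f^*TM_2}}\omega\rangle\,d\mathrm{Vol}_1=\int_{M_1}\langle\nabla^{f^*TM_2}\sigma,\omega\rangle\,d\mathrm{Vol}_1$$ for all smooth sections $\sigma$ of $f^*TM_2$ with compact support in the interior of $M_1$. Then the coderivative $\delta_{\nabla^{f^*TM_2}}\operatorname{Cof}df$ exists and is unique, and for every smooth vector field $X$ on $M_2$ the vector field $\operatorname{Piola}(X)$ is smooth and, at every point of $M_1$, $$\operatorname{div}\operatorname{Piola}(X)=\big((\operatorname{div}X)\circ f\big)\,\operatorname{Det}df-\big\langle f^*X,\ \delta_{\nabla^{f^*TM_2}}\operatorname{Cof}df\big\rangle .$$ -/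

import Mathlib

open Bundle Set Filter Topology MeasureTheory
open scoped Manifold ContDiff

noncomputable section

namespace Piola

/-! ### Linear algebra: Hodge dual, determinant and cofactor -/

section LinearAlgebra

variable {d : ℕ}
  {V : Type*} [NormedAddCommGroup V] [InnerProductSpace ℝ V] [FiniteDimensional ℝ V]
  [Fact (Module.finrank ℝ V = d)]
  {W : Type*} [NormedAddCommGroup W] [InnerProductSpace ℝ W] [FiniteDimensional ℝ W]
  [Fact (Module.finrank ℝ W = d)]

/-- The unit volume form of an oriented inner product space, as a linear functional on the whole
exterior algebra: it sends `v₁ ∧ ⋯ ∧ v_d` to `Vol (v₁, …, v_d)` and vanishes in degrees `≠ d`. -/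
def volFunctional (o : Orientation ℝ V (Fin d)) : ExteriorAlgebra ℝ V →ₗ[ℝ] ℝ :=
  ExteriorAlgebra.liftAlternating (R := ℝ) (M := V) (N := ℝ) (Pi.single d o.volumeForm)

/-- The Hodge dual `⋆ᵏ : Λ_k V → Λ_l V`, where `k + l = d`. With `e` an orthonormal basis of `V` and
`e_S = e_{s₁} ∧ ⋯ ∧ e_{s_l}` (`s₁ < ⋯ < s_l`) the induced orthonormal basis of `Λ_l V`, it is
`⋆β = ∑_S Vol (β ∧ e_S) e_S`; equivalently `α ∧ ⋆β = ⟨α, β⟩ Vol`. -/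
def hodgeStar (o : Orientation ℝ V (Fin d)) (k l : ℕ) : ⋀[ℝ]^k V →ₗ[ℝ] ⋀[ℝ]^l V :=
  ∑ S : Set.powersetCard (Fin (Module.finrank ℝ V)) l,
    LinearMap.smulRight
      (volFunctional o ∘ₗ
        LinearMap.mulRight ℝ
          (exteriorPower.ιMulti_family ℝ l (stdOrthonormalBasis ℝ V) S : ExteriorAlgebra ℝ V) ∘ₗ
        (⋀[ℝ]^k V).subtype)
      (exteriorPower.ιMulti_family ℝ l (stdOrthonormalBasis ℝ V) S)

/-- The intrinsic determinant `Det A = ⋆_W^d ∘ Λ^d A ∘ ⋆_V^0`, with `Λ_0 ≃ ℝ`. -/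
def Det (oV : Orientation ℝ V (Fin d)) (oW : Orientation ℝ W (Fin d)) (A : V →ₗ[ℝ] W) : ℝ :=
  exteriorPower.zeroEquiv ℝ W
    (hodgeStar oW d 0 (exteriorPower.map d A
      (hodgeStar oV 0 d ((exteriorPower.zeroEquiv ℝ V).symm 1))))

/-- The intrinsic cofactor `Cof A = (-1)^(d-1) ⋆_W^{d-1} ∘ Λ^{d-1} A ∘ ⋆_V^1`, with `Λ_1 V ≃ V` and
`Λ_1 W ≃ W`. -/
def Cof (oV : Orientation ℝ V (Fin d)) (oW : Orientation ℝ W (Fin d)) (A : V →ₗ[ℝ] W) :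
    V →ₗ[ℝ] W :=
  ((-1 : ℝ) ^ (d - 1)) •
    ((exteriorPower.oneEquiv ℝ W).toLinearMap ∘ₗ hodgeStar oW (d - 1) 1 ∘ₗ
      exteriorPower.map (d - 1) A ∘ₗ hodgeStar oV 1 (d - 1) ∘ₗ
      (exteriorPower.oneEquiv ℝ V).symm.toLinearMap)

end LinearAlgebra

/-! ### Oriented Riemannian manifolds, possibly with boundary -/

section Manifold

variable {d : ℕ}
  {H : Type*} [TopologicalSpace H] (I : ModelWithCorners ℝ (EuclideanSpace ℝ (Fin d)) H)
  {M : Type*} [TopologicalSpace M] [ChartedSpace H M]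

instance instFiniteDimensionalTangent (p : M) : FiniteDimensional ℝ (TangentSpace I p) :=
  inferInstanceAs (FiniteDimensional ℝ (EuclideanSpace ℝ (Fin d)))

instance instFactFinrankTangent (p : M) : Fact (Module.finrank ℝ (TangentSpace I p) = d) :=
  ⟨finrank_euclideanSpace_fin (𝕜 := ℝ) (n := d)⟩

variable (M) in
/-- An orientation of a manifold: an orientation of every tangent space which, near every point, is
constant when read in the local trivialization of the tangent bundle around that point. -/
structure ManifoldOrientation [IsManifold I 1 M] where
  /-- The orientation of the tangent space at a point. -/
  or : ∀ p : M, Orientation ℝ (TangentSpace I p) (Fin d)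
  locally_constant : ∀ p : M, ∃ c : Orientation ℝ (EuclideanSpace ℝ (Fin d)) (Fin d),
    ∀ᶠ q in 𝓝 p,
      ∀ hq : q ∈ (trivializationAt (EuclideanSpace ℝ (Fin d)) (TangentSpace I (M := M)) p).baseSet,
        Orientation.map (Fin d)
          ((trivializationAt (EuclideanSpace ℝ (Fin d)) (TangentSpace I (M := M))
            p).continuousLinearEquivAt ℝ q hq).toLinearEquiv (or q) = c

variable [IsManifold I 1 M] [RiemannianBundle (fun x : M ↦ TangentSpace I x)]

/-- The coordinate vector field `∂_i` of the chart around `p`, at the point `q` of its domain. -/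
def coordVector (p q : M) (i : Fin d) : TangentSpace I q :=
  (trivializationAt (EuclideanSpace ℝ (Fin d)) (TangentSpace I (M := M)) p).symm q
    (EuclideanSpace.single i (1 : ℝ))

/-- The Riemannian volume on the domain of the chart around `p`, as a measure on `M`: the image
under the inverse chart of `√(det (g_ij)) dx`. -/
def chartVolume [MeasurableSpace M] (p : M) : Measure M :=
  Measure.map (extChartAt I p).symm
    (((volume : Measure (EuclideanSpace ℝ (Fin d))).withDensity fun y ↦
      ENNReal.ofReal (√ (Matrix.det (Matrix.of fun i j : Fin d ↦
        inner ℝ (coordVector I p ((extChartAt I p).symm y) i)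
          (coordVector I p ((extChartAt I p).symm y) j))))).restrict
      (extChartAt I p).target)

variable (M) in
/-- The Riemannian volume measure. The measures `√(det g) dx` of the charts agree on overlaps,
so their supremum is the measure that restricts to each of them. -/
def riemannianVolume [MeasurableSpace M] : Measure M :=
  ⨆ p : M, chartVolume I p

/-- The right-hand side of the Koszul formula for `2 ⟨∇_U X, W⟩`:
`U⟨X,W⟩ + X⟨U,W⟩ - W⟨U,X⟩ + ⟨[U,X],W⟩ - ⟨[U,W],X⟩ - ⟨[X,W],U⟩`. -/
def koszul (U X W : ∀ q : M, TangentSpace I q) (p : M) : ℝ :=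
  mvfderiv I (fun q ↦ inner ℝ (X q) (W q)) p (U p)
    + mvfderiv I (fun q ↦ inner ℝ (U q) (W q)) p (X p)
    - mvfderiv I (fun q ↦ inner ℝ (U q) (X q)) p (W p)
    + inner ℝ (VectorField.mlieBracket I U X p) (W p)
    - inner ℝ (VectorField.mlieBracket I U W p) (X p)
    - inner ℝ (VectorField.mlieBracket I X W p) (U p)

/-- The Levi-Civita connection, `leviCivita I X p u = (∇_u X)(p)`: the tangent vector at `p` with
`2 ⟨∇_u X, w⟩` given by the Koszul formula for all `w`, where `u` and `w` are extended to smooth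
local vector fields. -/
def leviCivita (X : ∀ q : M, TangentSpace I q) (p : M) (u : TangentSpace I p) : TangentSpace I p :=
  ∑ i, ((1 / 2 : ℝ) * koszul I (FiberBundle.extend (EuclideanSpace ℝ (Fin d)) u) X
      (FiberBundle.extend (EuclideanSpace ℝ (Fin d)) (stdOrthonormalBasis ℝ (TangentSpace I p) i))
      p) • stdOrthonormalBasis ℝ (TangentSpace I p) i

/-- The divergence `div X = tr (∇ X) = ∑ i, ⟨∇_{e_i} X, e_i⟩`. -/
def divergence (X : ∀ q : M, TangentSpace I q) (p : M) : ℝ :=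
  ∑ i, inner ℝ (leviCivita I X p (stdOrthonormalBasis ℝ (TangentSpace I p) i))
    (stdOrthonormalBasis ℝ (TangentSpace I p) i)

end Manifold

/-! ### Maps between Riemannian manifolds -/

section Maps

variable {d : ℕ}
  {H₁ : Type*} [TopologicalSpace H₁] (I₁ : ModelWithCorners ℝ (EuclideanSpace ℝ (Fin d)) H₁)
  {M₁ : Type*} [TopologicalSpace M₁] [ChartedSpace H₁ M₁] [IsManifold I₁ 1 M₁]
  [RiemannianBundle (fun x : M₁ ↦ TangentSpace I₁ x)]
  {H₂ : Type*} [TopologicalSpace H₂] (I₂ : ModelWithCorners ℝ (EuclideanSpace ℝ (Fin d)) H₂)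
  {M₂ : Type*} [TopologicalSpace M₂] [ChartedSpace H₂ M₂] [IsManifold I₂ 1 M₂]
  [RiemannianBundle (fun x : M₂ ↦ TangentSpace I₂ x)]

/-- `σ` is a smooth section of `f^* TM₂`, i.e. `p ↦ (f p, σ p)` is a smooth map `M₁ → TM₂`. -/
def IsSmoothAlong (f : M₁ → M₂) (σ : ∀ p : M₁, TangentSpace I₂ (f p)) : Prop :=
  ContMDiff I₁ I₂.tangent ∞ (fun p ↦ (⟨f p, σ p⟩ : TangentBundle I₂ M₂))

/-- The connection on `f^* TM₂` induced by the Levi-Civita connection of `M₂`,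
`pullbackConnection I₁ I₂ f σ p u = (∇_u σ)(p)`. Write `σ = ∑ a, σ^a (E_a ∘ f)` near `p`, with `E_a`
the coordinate frame of the chart around `f p`; then `∇_u σ = ∑ a, dσ^a(u) E_a + σ^a ∇_{df u} E_a`.
The first sum is the derivative of the coordinate vector of `σ`, and the second one is `∇_{df u}` of
the field which is constant in the frame `E_a` and takes the value `σ p` at `f p`. -/
def pullbackConnection (f : M₁ → M₂) (σ : ∀ p : M₁, TangentSpace I₂ (f p)) (p : M₁)
    (u : TangentSpace I₁ p) : TangentSpace I₂ (f p) :=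
  (trivializationAt (EuclideanSpace ℝ (Fin d)) (TangentSpace I₂ (M := M₂)) (f p)).symm (f p)
      (mvfderiv I₁ (fun q ↦
        ((trivializationAt (EuclideanSpace ℝ (Fin d)) (TangentSpace I₂ (M := M₂)) (f p))
          ⟨f q, σ q⟩).2) p u)
    + leviCivita I₂ (FiberBundle.extend (EuclideanSpace ℝ (Fin d)) (σ p)) (f p)
        (mfderiv I₁ I₂ f p u)

/-- `η` is the coderivative of the `f^* TM₂`-valued one-form `α`: it is a smooth section of `f^* TM₂`
and `∫ ⟨σ, η⟩ dVol = ∫ ⟨∇σ, α⟩ dVol` for every smooth section `σ` of `f^* TM₂` with compact support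
in the interior of `M₁`. The inner product of one-forms is
`⟨∇σ, α⟩ = ∑ i, ⟨∇_{e_i} σ, α e_i⟩` for an orthonormal basis `e_i`. -/
structure IsCoderivative [MeasurableSpace M₁] (f : M₁ → M₂)
    (α : ∀ p : M₁, TangentSpace I₁ p →ₗ[ℝ] TangentSpace I₂ (f p))
    (η : ∀ p : M₁, TangentSpace I₂ (f p)) : Prop where
  smooth : IsSmoothAlong I₁ I₂ f η
  adjoint : ∀ σ : ∀ p : M₁, TangentSpace I₂ (f p), IsSmoothAlong I₁ I₂ f σ →
    IsCompact (closure {p | σ p ≠ 0}) → closure {p | σ p ≠ 0} ⊆ I₁.interior M₁ →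
    ∫ p, inner ℝ (σ p) (η p) ∂(riemannianVolume I₁ M₁) =
      ∫ p, ∑ i, inner ℝ
          (pullbackConnection I₁ I₂ f σ p (stdOrthonormalBasis ℝ (TangentSpace I₁ p) i))
          (α p (stdOrthonormalBasis ℝ (TangentSpace I₁ p) i)) ∂(riemannianVolume I₁ M₁)

variable {I₁ I₂} (o₁ : ManifoldOrientation I₁ M₁) (o₂ : ManifoldOrientation I₂ M₂)

/-- The function `Det df` on `M₁`. -/
def detDifferential (f : M₁ → M₂) (p : M₁) : ℝ :=
  Det (o₁.or p) (o₂.or (f p)) (mfderiv I₁ I₂ f p).toLinearMap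

/-- The `f^* TM₂`-valued one-form `Cof df` on `M₁`. -/
def cofDifferential (f : M₁ → M₂) (p : M₁) : TangentSpace I₁ p →ₗ[ℝ] TangentSpace I₂ (f p) :=
  Cof (o₁.or p) (o₂.or (f p)) (mfderiv I₁ I₂ f p).toLinearMap

/-- The Piola transform `Piola(X) = (Cof df)^T (f^* X)`, a vector field on `M₁`. -/
def piola (f : M₁ → M₂) (X : ∀ y : M₂, TangentSpace I₂ y) (p : M₁) : TangentSpace I₁ p :=
  LinearMap.adjoint (cofDifferential o₁ o₂ f p) (X (f p))

end Maps

end Piola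

end

/-! The coderivative of Cof df is zero, which is the Piola identity in weak form. The zero section
therefore witnesses the existence statement, and the last term of the formula drops out. Everything
rests on one pointwise formula, valid for every smooth section σ of f^*TM₂: ⟨∇σ, Cof df⟩ = div((Cof
df)^T σ). In coordinates this is `coordVol_mul_connectionInnerCof`.

To see why it holds, let φ be f read in charts and s the coordinates of σ. By Cramer's formula, √g₁
times the i-th component of (Cof df)^T σ is, up to a locally constant sign, √g₂ ∘ φ times the
determinant of Dφ with its i-th column replaced by s. Take the coordinate divergence. The terms with
second derivatives of φ cancel in pairs, because second derivatives are symmetric and the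
determinant is alternating (`sum_fderivWithin_substitution`). The terms with ds give the derivative
part of ∇σ. The derivative of √g₂ contributes det Dφ · d√g₂(s), again by Cramer's rule; this is the
Christoffel part of ∇σ, because the trace of u ↦ ∇_u s, for s constant in the frame, is d(log
√g₂)(s) (`divergence_eq`).

The pointwise formula has two consequences. For σ = X ∘ f the chain rule gives ∇σ = ∇X ∘ df, and df
∘ (Cof df)^T = Det df · id (`comp_adjoint_Cof`), so the trace equals (div X ∘ f) Det df; this is
`divergence_piola`. For σ compactly supported in the interior, a partition of unity reduces to one
chart, where the integral of a coordinate divergence vanishes; this is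
`integral_connectionInnerCof`. Uniqueness follows by testing a coderivative against itself times a
bump function: it vanishes in the interior, which is dense.

Boundary points are covered by taking all derivatives within `range I`, a set of unique
differentiability contained in the closure of its interior. -/

noncomputable section

namespace Piola

/-! ### Alternating forms of top degree -/

section TopForms

variable {d : ℕ}
  {V : Type*} [AddCommGroup V] [Module ℝ V] {W : Type*} [AddCommGroup W] [Module ℝ W]

/-- Substituting `w` for each argument in turn, weighted by `ℓ`, is an alternating operation. -/
lemma exists_alternating_substitution (α : W [⋀^Fin d]→ₗ[ℝ] ℝ) (A : V →ₗ[ℝ] W) (ℓ : V →ₗ[ℝ] ℝ)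
    (w : W) : ∃ Θ : V [⋀^Fin d]→ₗ[ℝ] ℝ,
      ∀ v, Θ v = ∑ i, ℓ (v i) * α (Function.update (A ∘ v) i w) := by
  cases d with
  | zero => exact ⟨0, fun v ↦ by simp⟩
  | succ k =>
    -- The form is the alternatization of ℓ ⊗ α(w, A·, …, A·). Moving w from slot i to the front
    -- costs (-1)^i, which is also the sign of the i-th term of the alternatization.
    refine ⟨AlternatingMap.alternatizeUncurryFin
      (ℓ.smulRight ((α.curryLeft w).compLinearMap A)), fun v ↦ ?_⟩
    rw [AlternatingMap.alternatizeUncurryFin_apply]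
    refine Finset.sum_congr rfl fun i _ ↦ ?_
    have : Function.update (A ∘ v) i w = i.insertNth w (A ∘ i.removeNth v) := by
      rw [← Fin.insertNth_removeNth]; rfl
    rw [this, AlternatingMap.map_insertNth]
    simp only [LinearMap.smulRight_apply, AlternatingMap.smul_apply, smul_eq_mul,
      AlternatingMap.compLinearMap_apply, AlternatingMap.curryLeft_apply_apply, zsmul_eq_mul,
      Int.cast_pow, Int.cast_neg, Int.cast_one]
    simp only [Function.comp_def]
    ring

/-- Changing the basis in a sum of substitutions multiplies it by the determinant. -/
lemma sum_substitution_basis (α : W [⋀^Fin d]→ₗ[ℝ] ℝ) (A : V →ₗ[ℝ] W) (ℓ : V →ₗ[ℝ] ℝ)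
    (w : W) (e : Module.Basis (Fin d) ℝ V) (v : Fin d → V) :
    ∑ i, ℓ (v i) * α (Function.update (A ∘ v) i w) =
      e.det v * ∑ i, ℓ (e i) * α (Function.update (A ∘ e) i w) := by
  -- Top-degree alternating forms are multiples of `e.det`, so Θ is determined by its value on e.
  obtain ⟨Θ, hΘ⟩ := exists_alternating_substitution α A ℓ w
  rw [← hΘ, ← hΘ]
  conv_lhs => rw [Θ.eq_smul_basis_det e]
  simp [mul_comm]

lemma alternating_update_basis (α : W [⋀^Fin d]→ₗ[ℝ] ℝ) (e : Module.Basis (Fin d) ℝ W) (i : Fin d)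
    (w : W) : α (Function.update e i w) = e.repr w i * α e := by
  conv_lhs => rw [← e.sum_repr w]
  rw [AlternatingMap.map_update_sum, Finset.sum_eq_single i]
  · rw [AlternatingMap.map_update_smul, Function.update_eq_self, smul_eq_mul]
  · intro j _ hj
    rw [AlternatingMap.map_update_smul, AlternatingMap.map_update_self _ _ (Ne.symm hj),
      smul_zero]
  · simp

/-- Cramer's rule for a top-degree alternating form. -/
lemma sum_substitution_id (α : W [⋀^Fin d]→ₗ[ℝ] ℝ) (e : Module.Basis (Fin d) ℝ W)
    (ℓ : W →ₗ[ℝ] ℝ) (w : W) (v : Fin d → W) :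
    ∑ i, ℓ (v i) * α (Function.update v i w) = α v * ℓ w := by
  -- Both sides are alternating in v, so it suffices to compare them on a basis, where putting w
  -- into slot i reads off its i-th coordinate.
  have h := sum_substitution_basis α LinearMap.id ℓ w e v
  simp only [LinearMap.id_coe, Function.id_comp] at h
  rw [h]
  simp only [alternating_update_basis]
  have h3 : ℓ w = ∑ i, e.repr w i * ℓ (e i) := by
    conv_lhs => rw [← e.sum_repr w]
    simp only [map_sum, map_smul, smul_eq_mul]
  have h4 : α v = e.det v * α e := by
    conv_lhs => rw [α.eq_smul_basis_det e]
    simp [mul_comm]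
  rw [h3, h4, mul_assoc, Finset.mul_sum (a := α e)]
  congr 1
  exact Finset.sum_congr rfl fun i _ ↦ by ring

/-- Cramer's rule, in vector form. -/
lemma sum_substitution_smul (α : W [⋀^Fin d]→ₗ[ℝ] ℝ) (e : Module.Basis (Fin d) ℝ W)
    (w : W) (v : Fin d → W) :
    ∑ i, α (Function.update v i w) • v i = α v • w := by
  refine e.ext_elem fun j ↦ ?_
  have := sum_substitution_id α e (e.coord j) w v
  simpa [mul_comm] using this

/-- An endomorphism acts on top-degree alternating forms, as a derivation, by its trace. -/
lemma sum_substitution_trace (α : W [⋀^Fin d]→ₗ[ℝ] ℝ) (e : Module.Basis (Fin d) ℝ W)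
    (L : W →ₗ[ℝ] W) (v : Fin d → W) :
    ∑ i, α (Function.update v i (L (v i))) = α v * LinearMap.trace ℝ W L := by
  -- Expanding L (v i) in the basis e reduces the claim to Cramer's rule for the functionals e_k^* ∘
  -- L at the vectors e_k, whose values sum to the trace.
  have hL : ∀ i, α (Function.update v i (L (v i))) =
      ∑ k, e.coord k (L (v i)) * α (Function.update v i (e k)) := by
    intro i
    conv_lhs => rw [← e.sum_repr (L (v i))]
    rw [AlternatingMap.map_update_sum]
    exact Finset.sum_congr rfl fun k _ ↦ by
      rw [AlternatingMap.map_update_smul, smul_eq_mul, Module.Basis.coord_apply]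
  simp only [hL]
  rw [Finset.sum_comm, LinearMap.trace_eq_matrix_trace ℝ e, Matrix.trace, Finset.mul_sum]
  refine Finset.sum_congr rfl fun k _ ↦ ?_
  have := sum_substitution_id α e (e.coord k ∘ₗ L) (e k) v
  simpa [LinearMap.toMatrix_apply] using this

end TopForms

/-! ### Hodge duals in an orthonormal frame -/

section LinearAlgebra

variable {d : ℕ}
  {V : Type*} [NormedAddCommGroup V] [InnerProductSpace ℝ V] [FiniteDimensional ℝ V]
  [hV : Fact (Module.finrank ℝ V = d)]
  {W : Type*} [NormedAddCommGroup W] [InnerProductSpace ℝ W] [FiniteDimensional ℝ W]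
  [hW : Fact (Module.finrank ℝ W = d)]

variable (d V) in
/-- The standard orthonormal basis, indexed by `Fin d`. -/
def stdFrame : OrthonormalBasis (Fin d) ℝ V :=
  (stdOrthonormalBasis ℝ V).reindex (finCongr hV.out)

lemma sum_stdOrthonormalBasis {N : Type*} [AddCommMonoid N] (F : V → N) :
    ∑ i, F (stdOrthonormalBasis ℝ V i) = ∑ i, F (stdFrame d V i) := by
  simp only [stdFrame, OrthonormalBasis.reindex_apply]
  exact (Equiv.sum_comp (finCongr hV.out).symm fun i ↦ F (stdOrthonormalBasis ℝ V i)).symm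

lemma hodgeStar_apply (o : Orientation ℝ V (Fin d)) (k l : ℕ) (β : ⋀[ℝ]^k V) :
    hodgeStar o k l β = ∑ S : Set.powersetCard (Fin d) l,
      volFunctional o (β * ExteriorAlgebra.ιMulti_family ℝ l (stdFrame d V) S) •
        exteriorPower.ιMulti_family ℝ l (stdFrame d V) S := by
  -- The index type `Fin (finrank ℝ V)` equals `Fin d` only propositionally; with the dimension
  -- generalized, the equation can be substituted away.
  have key : ∀ (n : ℕ) (h : n = d) (e : Fin n → V),
      ∑ S : Set.powersetCard (Fin n) l,
        volFunctional o (β * ExteriorAlgebra.ιMulti_family ℝ l e S) •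
          exteriorPower.ιMulti_family ℝ l e S =
      ∑ S : Set.powersetCard (Fin d) l,
        volFunctional o (β * ExteriorAlgebra.ιMulti_family ℝ l (e ∘ (finCongr h).symm) S) •
          exteriorPower.ιMulti_family ℝ l (e ∘ (finCongr h).symm) S := by
    rintro n rfl e
    rfl
  have h2 : ((stdFrame d V : Fin d → V)) =
      stdOrthonormalBasis ℝ V ∘ (finCongr hV.out).symm := by
    ext1 i; simp [stdFrame]
  rw [h2, ← key _ hV.out, hodgeStar, LinearMap.sum_apply]
  rfl

lemma volFunctional_ιMulti (o : Orientation ℝ V (Fin d)) (v : Fin d → V) :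
    volFunctional o (ExteriorAlgebra.ιMulti ℝ d v) = o.volumeForm v := by
  rw [volFunctional, ExteriorAlgebra.liftAlternating_apply_ιMulti]
  simp

lemma volumeForm_stdFrame_mul_self (o : Orientation ℝ V (Fin d)) :
    o.volumeForm (stdFrame d V) * o.volumeForm (stdFrame d V) = 1 := by
  have h := o.abs_volumeForm_apply_of_orthonormal (stdFrame d V)
  rw [← abs_mul_abs_self, h, one_mul]

lemma volumeForm_eq_det_mul (o : Orientation ℝ V (Fin d)) (e : Module.Basis (Fin d) ℝ V)
    (v : Fin d → V) : o.volumeForm v = e.det v * o.volumeForm e := by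
  conv_lhs => rw [o.volumeForm.eq_smul_basis_det e]
  simp [mul_comm]

lemma volumeForm_basis_ne_zero (o : Orientation ℝ V (Fin d)) (e : Module.Basis (Fin d) ℝ V) :
    o.volumeForm e ≠ 0 := by
  intro h
  have := volumeForm_stdFrame_mul_self o
  rw [volumeForm_eq_det_mul o e, h] at this
  simp at this

/-- The square of the volume form is the Gram determinant. -/
lemma volumeForm_sq (o : Orientation ℝ V (Fin d)) (v : Fin d → V) :
    o.volumeForm v ^ 2 = Matrix.det (Matrix.of fun i j ↦ inner ℝ (v i) (v j)) := by
  have h : (Matrix.of fun i j ↦ inner ℝ (v i) (v j)) =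
      ((stdFrame d V).toBasis.toMatrix v).transpose * (stdFrame d V).toBasis.toMatrix v := by
    ext i j
    rw [Matrix.mul_apply, Matrix.of_apply, ← (stdFrame d V).sum_inner_mul_inner]
    refine Finset.sum_congr rfl fun k _ ↦ ?_
    simp [Module.Basis.toMatrix_apply, OrthonormalBasis.repr_apply_apply, real_inner_comm]
  rw [h, Matrix.det_mul, Matrix.det_transpose, ← Module.Basis.det_apply,
    volumeForm_eq_det_mul o (stdFrame d V).toBasis, mul_pow, OrthonormalBasis.coe_toBasis,
    sq (o.volumeForm _), volumeForm_stdFrame_mul_self]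
  ring

/-- Between degrees 0 and d the sum defining the Hodge dual has a single term. The factor Vol(e) =
±1 stays because the standard orthonormal basis need not be positively oriented. -/
lemma Det_eq_stdFrame (oV : Orientation ℝ V (Fin d)) (oW : Orientation ℝ W (Fin d))
    (A : V →ₗ[ℝ] W) :
    Det oV oW A = oV.volumeForm (stdFrame d V) * oW.volumeForm (A ∘ stdFrame d V) := by
  have h1 : hodgeStar oV 0 d ((exteriorPower.zeroEquiv ℝ V).symm 1) =
      oV.volumeForm (stdFrame d V) • exteriorPower.ιMulti ℝ d (stdFrame d V) := by
    rw [hodgeStar_apply]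
    have hu : ∀ S : Set.powersetCard (Fin d) d,
        S = ⟨Finset.univ, by simp [Set.powersetCard.mem_iff]⟩ := by
      intro S
      refine Subtype.ext ((Finset.card_eq_iff_eq_univ _).1 ?_)
      simp
    have : Unique (Set.powersetCard (Fin d) d) := ⟨⟨_⟩, hu⟩
    rw [Fintype.sum_unique]
    have he : ∀ S : Set.powersetCard (Fin d) d,
        (⇑(Set.powersetCard.ofFinEmbEquiv.symm S) : Fin d → Fin d) = id := by
      intro S
      have : Set.powersetCard.ofFinEmbEquiv.symm S = (OrderIso.refl (Fin d)).toOrderEmbedding := by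
        rw [Equiv.symm_apply_eq, hu S]
        exact (hu _).symm
      rw [this]; rfl
    simp only [exteriorPower.ιMulti_family, ExteriorAlgebra.ιMulti_family, he, Function.comp_id]
    congr 1
    rw [exteriorPower.zeroEquiv_symm_apply]
    simp [volFunctional_ιMulti]
  have h2 : ∀ v : Fin d → W, exteriorPower.zeroEquiv ℝ W
      (hodgeStar oW d 0 (exteriorPower.ιMulti ℝ d v)) = oW.volumeForm v := by
    intro v
    rw [hodgeStar_apply]
    have hu : ∀ S : Set.powersetCard (Fin d) 0,
        S = ⟨∅, by simp [Set.powersetCard.mem_iff]⟩ := by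
      intro S
      refine Subtype.ext (Finset.card_eq_zero.1 ?_)
      simp
    have : Unique (Set.powersetCard (Fin d) 0) := ⟨⟨_⟩, hu⟩
    rw [Fintype.sum_unique, map_smul, exteriorPower.ιMulti_family, exteriorPower.zeroEquiv_ιMulti]
    simp [volFunctional_ιMulti]
  rw [Det, h1, map_smul, map_smul, map_smul, exteriorPower.map_apply_ιMulti, h2, smul_eq_mul]

/-- Frees `Det` from the orthonormal frame: under a change of basis both volume forms scale by the
same determinant, and Vol(e)² = 1. -/
lemma volumeForm_mul_Det (oV : Orientation ℝ V (Fin d)) (oW : Orientation ℝ W (Fin d))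
    (A : V →ₗ[ℝ] W) (b : Module.Basis (Fin d) ℝ V) :
    oV.volumeForm b * Det oV oW A = oW.volumeForm (A ∘ b) := by
  have h : oW.volumeForm (A ∘ b) =
      (stdFrame d V).toBasis.det b * oW.volumeForm (A ∘ stdFrame d V) := by
    have := (oW.volumeForm.compLinearMap A).eq_smul_basis_det (stdFrame d V).toBasis
    have h3 := congrArg (fun α : V [⋀^Fin d]→ₗ[ℝ] ℝ ↦ α b) this
    simp only [AlternatingMap.compLinearMap_apply, AlternatingMap.smul_apply, smul_eq_mul] at h3
    rw [mul_comm]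
    simpa [Function.comp_def] using h3
  have h2 := volumeForm_stdFrame_mul_self oV
  rw [Det_eq_stdFrame, h, volumeForm_eq_det_mul oV (stdFrame d V).toBasis b,
    OrthonormalBasis.coe_toBasis]
  linear_combination ((stdFrame d V).toBasis.det b * oW.volumeForm (A ∘ stdFrame d V)) * h2

/-- The free vector lands in the last slot because e_S stands to the right of β in the definition of
`hodgeStar`; the one-element subsets S are the indices themselves. -/
lemma inner_oneEquiv_hodgeStar {k : ℕ} {W : Type*} [NormedAddCommGroup W] [InnerProductSpace ℝ W]
    [FiniteDimensional ℝ W] [Fact (Module.finrank ℝ W = k + 1)]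
    (o : Orientation ℝ W (Fin (k + 1))) (u : Fin k → W) (w : W) :
    inner ℝ (exteriorPower.oneEquiv ℝ W (hodgeStar o k 1 (exteriorPower.ιMulti ℝ k u))) w =
      o.volumeForm (Fin.snoc u w) := by
  have hj : ∀ j : Fin (k + 1), (⇑(Set.powersetCard.ofFinEmbEquiv.symm
      (Set.powersetCard.ofSingleton j)) : Fin 1 → Fin (k + 1)) = fun _ ↦ j := by
    intro j
    ext1 i
    have := (Set.powersetCard.mem_range_ofFinEmbEquiv_symm_iff_mem
      (Set.powersetCard.ofSingleton j) (Set.powersetCard.ofFinEmbEquiv.symm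
      (Set.powersetCard.ofSingleton j) i)).1 ⟨i, rfl⟩
    simpa [Set.powersetCard.ofSingleton, ← Set.powersetCard.mem_coe_iff] using this
  rw [hodgeStar_apply, ← Equiv.sum_comp Set.powersetCard.ofSingleton, map_sum, sum_inner]
  simp only [map_smul, exteriorPower.ιMulti_family, ExteriorAlgebra.ιMulti_family, hj,
    exteriorPower.oneEquiv_ιMulti, exteriorPower.ιMulti_apply_coe,
    ExteriorAlgebra.ιMulti_mul_ιMulti, volFunctional_ιMulti, real_inner_smul_left]
  have h1 : ∀ x : W, o.volumeForm (Fin.snoc u x) =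
      o.volumeForm (Function.update (Fin.snoc u 0 : Fin (k + 1) → W) (Fin.last k) x) := by
    intro x; rw [Fin.update_snoc_last]
  rw [h1 w]
  conv_rhs => rw [← (stdFrame (k + 1) W).sum_repr' w]
  rw [AlternatingMap.map_update_sum]
  refine Finset.sum_congr rfl fun j _ ↦ ?_
  rw [AlternatingMap.map_update_smul, ← h1, smul_eq_mul, mul_comm]
  congr 2
  exact Fin.append_right_eq_snoc _ _

/-- The k-element subsets of k + 1 indices are the complements of single points, and the complement
of i is enumerated in increasing order by `i.succAbove`. -/
lemma hodgeStar_oneEquiv_symm {k : ℕ} {V : Type*} [NormedAddCommGroup V] [InnerProductSpace ℝ V]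
    [FiniteDimensional ℝ V] [Fact (Module.finrank ℝ V = k + 1)]
    (o : Orientation ℝ V (Fin (k + 1))) (v : V) :
    hodgeStar o 1 k ((exteriorPower.oneEquiv ℝ V).symm v) =
      ∑ i : Fin (k + 1), o.volumeForm (Matrix.vecCons v (stdFrame (k + 1) V ∘ i.succAbove)) •
        exteriorPower.ιMulti ℝ k (stdFrame (k + 1) V ∘ i.succAbove) := by
  have hc : k + 1 = Fintype.card (Fin (k + 1)) := by simp
  rw [hodgeStar_apply, ← Equiv.sum_comp
    (Set.powersetCard.ofSingleton.trans (Set.powersetCard.compl hc))]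
  have hj : ∀ j : Fin (k + 1), (⇑(Set.powersetCard.ofFinEmbEquiv.symm
      ((Set.powersetCard.ofSingleton.trans (Set.powersetCard.compl hc)) j)) :
        Fin k → Fin (k + 1)) = j.succAbove := by
    intro j
    have : Set.powersetCard.ofFinEmbEquiv.symm
      ((Set.powersetCard.ofSingleton.trans (Set.powersetCard.compl hc)) j) =
        Fin.succAboveOrderEmb j := by
      rw [Equiv.symm_apply_eq]
      refine SetLike.ext fun x ↦ ?_
      have hx := Set.powersetCard.mem_range_ofFinEmbEquiv_symm_iff_mem
        (Set.powersetCard.ofFinEmbEquiv (Fin.succAboveOrderEmb j)) x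
      rw [Equiv.symm_apply_apply] at hx
      rw [← hx]
      simp [Set.powersetCard.ofSingleton, ← Set.powersetCard.mem_coe_iff]
    rw [this]; rfl
  refine Finset.sum_congr rfl fun j _ ↦ ?_
  simp only [exteriorPower.ιMulti_family, ExteriorAlgebra.ιMulti_family, hj]
  congr 1
  rw [← volFunctional_ιMulti, ExteriorAlgebra.ιMulti_succ_apply, exteriorPower.oneEquiv_symm_apply]
  simp [ExteriorAlgebra.ιMulti_succ_apply, Matrix.vecTail, Function.comp_def]

/-- The signs in the definition of `Cof` are made to cancel. With k = d - 1, moving w from the last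
slot to slot i costs (-1)^(k-i), moving v from the first slot to slot i costs (-1)^i, and the
normalizing factor is (-1)^k. -/
lemma inner_Cof [NeZero d] (oV : Orientation ℝ V (Fin d)) (oW : Orientation ℝ W (Fin d))
    (A : V →ₗ[ℝ] W) (v : V) (w : W) :
    inner ℝ (Cof oV oW A v) w = oV.volumeForm (stdFrame d V) * ∑ i, inner ℝ v (stdFrame d V i) *
      oW.volumeForm (Function.update (A ∘ stdFrame d V) i w) := by
  obtain ⟨k, rfl⟩ : ∃ k, d = k + 1 := Nat.exists_eq_succ_of_ne_zero (NeZero.ne d)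
  have h0 : Cof oV oW A v = ((-1 : ℝ) ^ k) • exteriorPower.oneEquiv ℝ W (hodgeStar oW k 1
      (exteriorPower.map k A (hodgeStar oV 1 k ((exteriorPower.oneEquiv ℝ V).symm v)))) := rfl
  rw [h0, hodgeStar_oneEquiv_symm]
  simp only [map_sum, map_smul, exteriorPower.map_apply_ιMulti, real_inner_smul_left, sum_inner,
    inner_oneEquiv_hodgeStar, Finset.mul_sum]
  refine Finset.sum_congr rfl fun i _ ↦ ?_
  have hs : (Fin.snoc (A ∘ (stdFrame (k + 1) V ∘ i.succAbove)) w : Fin (k + 1) → W) =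
      (Fin.last k).insertNth w (A ∘ (stdFrame (k + 1) V ∘ i.succAbove)) := by
    rw [Fin.insertNth_last']
  have hu : Function.update (A ∘ stdFrame (k + 1) V) i w =
      i.insertNth w (A ∘ (stdFrame (k + 1) V ∘ i.succAbove)) := by
    rw [← Fin.insertNth_removeNth]; rfl
  have hv : i.insertNth v (stdFrame (k + 1) V ∘ i.succAbove) =
      Function.update (stdFrame (k + 1) V) i v := by
    rw [← Fin.insertNth_removeNth]; rfl
  have hvol : oV.volumeForm (Function.update (stdFrame (k + 1) V) i v) =
      inner ℝ v (stdFrame (k + 1) V i) * oV.volumeForm (stdFrame (k + 1) V) := by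
    have := alternating_update_basis oV.volumeForm (stdFrame (k + 1) V).toBasis i v
    simpa [OrthonormalBasis.repr_apply_apply, real_inner_comm] using this
  rw [← hv, AlternatingMap.map_insertNth] at hvol
  rw [hs, hu, AlternatingMap.map_insertNth, AlternatingMap.map_insertNth]
  simp only [zsmul_eq_mul, Int.cast_pow, Int.cast_neg, Int.cast_one, Fin.val_last] at hvol ⊢
  have e1 : ((-1 : ℝ) ^ k) * (-1) ^ k = 1 := by rw [← mul_pow]; simp
  have e2 : ((-1 : ℝ) ^ (i : ℕ)) * (-1) ^ (i : ℕ) = 1 := by rw [← mul_pow]; simp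
  set P := oV.volumeForm (Matrix.vecCons v (stdFrame (k + 1) V ∘ i.succAbove))
  set Q := oW.volumeForm (Matrix.vecCons w (A ∘ (stdFrame (k + 1) V ∘ i.succAbove)))
  set R := inner ℝ v (stdFrame (k + 1) V i)
  set T := oV.volumeForm (stdFrame (k + 1) V)
  linear_combination (P * Q) * e1 - (P * Q) * e2 + (-1 : ℝ) ^ (i : ℕ) * Q * hvol

/-- The adjoint of the cofactor map in an arbitrary basis: it is given by Cramer's formula. -/
lemma volumeForm_smul_adjoint_Cof [NeZero d] (oV : Orientation ℝ V (Fin d))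
    (oW : Orientation ℝ W (Fin d)) (A : V →ₗ[ℝ] W) (b : Module.Basis (Fin d) ℝ V) (w : W) :
    oV.volumeForm b • LinearMap.adjoint (Cof oV oW A) w =
      ∑ i, oW.volumeForm (Function.update (A ∘ b) i w) • b i := by
  refine ext_inner_left ℝ fun v ↦ ?_
  rw [inner_smul_right, LinearMap.adjoint_inner_right, inner_Cof, inner_sum]
  -- Paired with v, both sides are sums of substitutions weighted by ⟨v, ·⟩, one in the orthonormal
  -- frame and one in b. They are related by the determinant of b, and the leftover factor Vol(e)²
  -- is 1.
  have h := sum_substitution_basis oW.volumeForm A (innerₗ V v) w (stdFrame d V).toBasis b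
  simp only [innerₗ_apply_apply, OrthonormalBasis.coe_toBasis] at h
  have h1 : ∑ i, inner ℝ v (oW.volumeForm (Function.update (A ∘ b) i w) • b i) =
      ∑ i, inner ℝ v (b i) * oW.volumeForm (Function.update (A ∘ b) i w) :=
    Finset.sum_congr rfl fun i _ ↦ by rw [inner_smul_right, mul_comm]
  rw [h1, h, volumeForm_eq_det_mul oV (stdFrame d V).toBasis b, OrthonormalBasis.coe_toBasis]
  have h2 := volumeForm_stdFrame_mul_self oV
  linear_combination ((stdFrame d V).toBasis.det b * ∑ i, inner ℝ v (stdFrame d V i) *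
      oW.volumeForm (Function.update (A ∘ stdFrame d V) i w)) * h2

/-- Applying A to Cramer's formula for the adjoint gives Cramer's rule for the vectors A e_i in W.
No inverse of A enters, so degenerate differentials are covered. -/
lemma comp_adjoint_Cof [NeZero d] (oV : Orientation ℝ V (Fin d)) (oW : Orientation ℝ W (Fin d))
    (A : V →ₗ[ℝ] W) (w : W) :
    A (LinearMap.adjoint (Cof oV oW A) w) = Det oV oW A • w := by
  have hb := volumeForm_basis_ne_zero oV (stdFrame d V).toBasis
  refine smul_right_injective W hb ?_
  change oV.volumeForm (stdFrame d V).toBasis • A (LinearMap.adjoint (Cof oV oW A) w) =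
    oV.volumeForm (stdFrame d V).toBasis • Det oV oW A • w
  rw [← map_smul, volumeForm_smul_adjoint_Cof, map_sum, smul_smul, volumeForm_mul_Det,
    ← sum_substitution_smul oW.volumeForm (stdFrame d W).toBasis]
  simp

lemma trace_eq_sum_inner (L : V →ₗ[ℝ] V) :
    LinearMap.trace ℝ V L = ∑ i, inner ℝ (L (stdOrthonormalBasis ℝ V i))
      (stdOrthonormalBasis ℝ V i) := by
  rw [LinearMap.trace_eq_sum_inner L (stdOrthonormalBasis ℝ V)]
  exact Finset.sum_congr rfl fun i _ ↦ real_inner_comm _ _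

end LinearAlgebra

/-! ### The Piola identity in a Euclidean space -/

section Euclidean

variable {d : ℕ} {E : Type*} [NormedAddCommGroup E] [NormedSpace ℝ E] [FiniteDimensional ℝ E]

lemma continuous_alternating (b : Module.Basis (Fin d) ℝ E) (ν : E [⋀^Fin d]→ₗ[ℝ] ℝ) :
    Continuous ν := by
  rw [ν.eq_smul_basis_det b]
  have : Continuous fun v : Fin d → E ↦ b.det v := by
    simp only [Module.Basis.det_apply]
    refine Continuous.matrix_det (continuous_pi fun i ↦ continuous_pi fun j ↦ ?_)
    exact (b.coord i).continuous_of_finiteDimensional.comp (continuous_apply j)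
  exact continuous_const.mul this

/-- The derivative of an alternating form of moving vectors. -/
lemma hasFDerivWithinAt_alternating {F : Type*} [NormedAddCommGroup F] [NormedSpace ℝ F]
    (b : Module.Basis (Fin d) ℝ E) (ν : E [⋀^Fin d]→ₗ[ℝ] ℝ) {m : Fin d → F → E} {m' : Fin d → F →L[ℝ] E} {s : Set F} {x : F}
    (hm : ∀ i, HasFDerivWithinAt (m i) (m' i) s x) :
    ∃ D : F →L[ℝ] ℝ, HasFDerivWithinAt (fun y ↦ ν fun i ↦ m i y) D s x ∧
      ∀ v, D v = ∑ i, ν (Function.update (fun j ↦ m j x) i (m' i v)) := by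
  let Ω : ContinuousMultilinearMap ℝ (fun _ : Fin d ↦ E) ℝ :=
    ⟨ν.toMultilinearMap, continuous_alternating b ν⟩
  refine ⟨_, HasFDerivWithinAt.multilinear_comp Ω hm, fun v ↦ ?_⟩
  rw [sum_apply]
  rfl

/-- The sum of the partial derivatives of the substitutions of `σ` into the columns of `Dφ`: the
terms that involve second derivatives of `φ` cancel. -/
lemma sum_fderivWithin_substitution (b : Module.Basis (Fin d) ℝ E) (ν : E [⋀^Fin d]→ₗ[ℝ] ℝ)
    {E' : Type*} [NormedAddCommGroup E'] [NormedSpace ℝ E'] (u : Fin d → E')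
    {φ : E' → E} {σ : E' → E} {s : Set E'} {x : E'} (hs : UniqueDiffOn ℝ s)
    (hx : x ∈ closure (interior s)) (hxs : x ∈ s)
    (hφ : ContDiffWithinAt ℝ 2 φ s x) (hσ : DifferentiableWithinAt ℝ σ s x) :
    (∀ i, DifferentiableWithinAt ℝ (fun y ↦ ν (Function.update
      (fun j ↦ fderivWithin ℝ φ s y (u j)) i (σ y))) s x) ∧
    ∑ i, fderivWithin ℝ (fun y ↦ ν (Function.update (fun j ↦ fderivWithin ℝ φ s y (u j)) i (σ y)))
        s x (u i) =
      ∑ i, ν (Function.update (fun j ↦ fderivWithin ℝ φ s x (u j)) i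
        (fderivWithin ℝ σ s x (u i))) := by
  -- Symmetry of the second derivative within s holds because x is a limit of interior points of s;
  -- this is what admits boundary points.
  have hsymm : IsSymmSndFDerivWithinAt ℝ φ s x := by
    refine hφ.isSymmSndFDerivWithinAt ?_ hs hx hxs
    simp [minSmoothness_of_isRCLikeNormedField]
  have hd : DifferentiableWithinAt ℝ (fderivWithin ℝ φ s) s x :=
    (hφ.fderivWithin_right hs (m := 1) (by norm_num) hxs).differentiableWithinAt one_ne_zero
  have hcol : ∀ j, HasFDerivWithinAt (fun y ↦ fderivWithin ℝ φ s y (u j))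
      ((ContinuousLinearMap.apply ℝ E (u j)) ∘L fderivWithin ℝ (fderivWithin ℝ φ s) s x) s x :=
    fun j ↦ (ContinuousLinearMap.apply ℝ E (u j)).hasFDerivAt.comp_hasFDerivWithinAt x
      hd.hasFDerivWithinAt
  have hex : ∀ i, ∃ D : E' →L[ℝ] ℝ, HasFDerivWithinAt (fun y ↦ ν (Function.update
      (fun j ↦ fderivWithin ℝ φ s y (u j)) i (σ y))) D s x ∧ ∀ v, D v =
        ∑ k, ν (Function.update (Function.update (fun j ↦ fderivWithin ℝ φ s x (u j)) i (σ x)) k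
          (if k = i then fderivWithin ℝ σ s x v
            else fderivWithin ℝ (fderivWithin ℝ φ s) s x v (u k))) := by
    intro i
    have hm : ∀ k, HasFDerivWithinAt
        (fun y ↦ Function.update (fun j ↦ fderivWithin ℝ φ s y (u j)) i (σ y) k)
        (if k = i then fderivWithin ℝ σ s x else
          (ContinuousLinearMap.apply ℝ E (u k)) ∘L fderivWithin ℝ (fderivWithin ℝ φ s) s x)
        s x := by
      intro k
      by_cases hk : k = i
      · subst hk
        simpa using hσ.hasFDerivWithinAt
      · simpa [Function.update_of_ne hk, hk] using hcol k
    obtain ⟨D, hD, hDv⟩ := hasFDerivWithinAt_alternating b ν hm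
    refine ⟨D, hD, fun v ↦ ?_⟩
    rw [hDv]
    refine Finset.sum_congr rfl fun k _ ↦ ?_
    by_cases hk : k = i <;> simp [hk]
  choose D hD hDv using hex
  refine ⟨fun i ↦ (hD i).differentiableWithinAt, ?_⟩
  have hf : ∀ i, fderivWithin ℝ (fun y ↦ ν (Function.update
      (fun j ↦ fderivWithin ℝ φ s y (u j)) i (σ y))) s x = D i :=
    fun i ↦ (hD i).fderivWithin (hs x hxs)
  simp only [hf, hDv]
  set c : Fin d → E := fun j ↦ fderivWithin ℝ φ s x (u j)
  set S : Fin d → Fin d → E := fun i k ↦ fderivWithin ℝ (fderivWithin ℝ φ s) s x (u i) (u k)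
  have hS : ∀ i k, S i k = S k i := fun i k ↦ hsymm (u i) (u k)
  -- In the product rule, slot k = i differentiates σ, and every other slot differentiates a column
  -- of Dφ and yields a second derivative S i k.
  have hsplit : ∀ i, ∑ k, ν (Function.update (Function.update c i (σ x)) k
      (if k = i then fderivWithin ℝ σ s x (u i) else S i k)) =
      ν (Function.update c i (fderivWithin ℝ σ s x (u i))) +
        ∑ k, if k = i then 0 else ν (Function.update (Function.update c i (σ x)) k (S i k)) := by
    intro i
    rw [← Finset.add_sum_erase _ _ (Finset.mem_univ i),
      ← Finset.add_sum_erase _ (fun k ↦ if k = i then 0 else _) (Finset.mem_univ i)]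
    simp only [if_true, zero_add, Function.update_idem]
    congr 1
    refine Finset.sum_congr rfl fun k hk ↦ ?_
    simp [Finset.ne_of_mem_erase hk]
  refine (Finset.sum_congr rfl fun i _ ↦ hsplit i).trans ?_
  rw [Finset.sum_add_distrib, add_eq_left]
  -- Exchanging i and k exchanges the slots of σ x and of S i k = S k i. This transposes two
  -- arguments of ν, so the double sum equals its own negative.
  have hanti : ∀ i k, (if k = i then 0 else
      ν (Function.update (Function.update c i (σ x)) k (S i k))) =
      -(if i = k then 0 else ν (Function.update (Function.update c k (σ x)) i (S k i))) := by
    intro i k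
    by_cases hk : k = i
    · simp [hk]
    · rw [if_neg hk, if_neg (Ne.symm hk), ← ν.map_swap _ hk, hS k i]
      congr 1
      ext1 j
      simp only [Function.comp_apply]
      by_cases hjk : j = k
      · subst hjk
        simp
      · by_cases hji : j = i
        · subst hji
          simp [hjk, hk]
        · simp [Equiv.swap_apply_of_ne_of_ne hjk hji, hjk, hji]
  have hsum := Finset.sum_comm (s := Finset.univ) (t := Finset.univ) (f := fun i k ↦
    if k = i then 0 else ν (Function.update (Function.update c i (σ x)) k (S i k)))
  have h2 : ∑ i, ∑ k, (if k = i then 0 else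
      ν (Function.update (Function.update c i (σ x)) k (S i k))) =
      -∑ i, ∑ k, (if i = k then 0 else
      ν (Function.update (Function.update c k (σ x)) i (S k i))) := by
    rw [← Finset.sum_neg_distrib]
    refine Finset.sum_congr rfl fun i _ ↦ ?_
    rw [← Finset.sum_neg_distrib]
    exact Finset.sum_congr rfl fun k _ ↦ hanti i k
  linarith

/-- The weighted Piola identity: with a weight `w ∘ φ` one more term appears. -/
lemma sum_fderivWithin_weighted_substitution (b : Module.Basis (Fin d) ℝ E)
    (ν : E [⋀^Fin d]→ₗ[ℝ] ℝ)
    {E' : Type*} [NormedAddCommGroup E'] [NormedSpace ℝ E'] (u : Fin d → E')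
    {φ : E' → E} {σ : E' → E} {w : E → ℝ} {s : Set E'} {t : Set E} {x : E'}
    (hs : UniqueDiffOn ℝ s) (hx : x ∈ closure (interior s)) (hxs : x ∈ s)
    (hφ : ContDiffWithinAt ℝ 2 φ s x) (hσ : DifferentiableWithinAt ℝ σ s x)
    (hst : MapsTo φ s t) (hw : DifferentiableWithinAt ℝ w t (φ x)) :
    ∑ i, fderivWithin ℝ (fun y ↦ w (φ y) *
        ν (Function.update (fun j ↦ fderivWithin ℝ φ s y (u j)) i (σ y))) s x (u i) =
      w (φ x) * ∑ i, ν (Function.update (fun j ↦ fderivWithin ℝ φ s x (u j)) i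
        (fderivWithin ℝ σ s x (u i))) +
      ν (fun j ↦ fderivWithin ℝ φ s x (u j)) * fderivWithin ℝ w t (φ x) (σ x) := by
  obtain ⟨h1, h2⟩ := sum_fderivWithin_substitution b ν u hs hx hxs hφ hσ
  have hφ' : HasFDerivWithinAt φ (fderivWithin ℝ φ s x) s x :=
    (hφ.differentiableWithinAt two_ne_zero).hasFDerivWithinAt
  have hwφ : HasFDerivWithinAt (fun y ↦ w (φ y))
      (fderivWithin ℝ w t (φ x) ∘L fderivWithin ℝ φ s x) s x :=
    hw.hasFDerivWithinAt.comp x hφ' hst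
  have hi : ∀ i, fderivWithin ℝ (fun y ↦ w (φ y) *
        ν (Function.update (fun j ↦ fderivWithin ℝ φ s y (u j)) i (σ y))) s x (u i) =
      w (φ x) * fderivWithin ℝ (fun y ↦
        ν (Function.update (fun j ↦ fderivWithin ℝ φ s y (u j)) i (σ y))) s x (u i) +
      fderivWithin ℝ w t (φ x) (fderivWithin ℝ φ s x (u i)) *
        ν (Function.update (fun j ↦ fderivWithin ℝ φ s x (u j)) i (σ x)) := by
    intro i
    rw [(hwφ.fun_mul (h1 i).hasFDerivWithinAt).fderivWithin (hs x hxs)]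
    simp only [add_apply, smul_apply, smul_eq_mul,
      ContinuousLinearMap.comp_apply]
    ring
  simp only [hi, Finset.sum_add_distrib, ← Finset.mul_sum, h2]
  congr 1
  -- The derivatives of the weight along the columns recombine by Cramer's rule into its derivative
  -- along σ x.
  exact sum_substitution_id ν b (fderivWithin ℝ w t (φ x)).toLinearMap (σ x) _

end Euclidean

/-! ### Coordinates of tangent vectors -/

section Coordinates

variable {d : ℕ}
  {H : Type*} [TopologicalSpace H] (I : ModelWithCorners ℝ (EuclideanSpace ℝ (Fin d)) H)
  {M : Type*} [TopologicalSpace M] [ChartedSpace H M] [IsManifold I 1 M]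

/-- The coordinates of a tangent vector at `q` in the chart around `p`. -/
def toCoord (p q : M) : TangentSpace I q →L[ℝ] EuclideanSpace ℝ (Fin d) :=
  (trivializationAt (EuclideanSpace ℝ (Fin d)) (TangentSpace I (M := M)) p).continuousLinearMapAt ℝ q

/-- The tangent vector at `q` with given coordinates in the chart around `p`. -/
def ofCoord (p q : M) : EuclideanSpace ℝ (Fin d) →L[ℝ] TangentSpace I q :=
  (trivializationAt (EuclideanSpace ℝ (Fin d)) (TangentSpace I (M := M)) p).symmL ℝ q

variable {I} {p q : M}

lemma toCoord_apply (hq : q ∈ (chartAt H p).source) (v : TangentSpace I q) :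
    toCoord I p q v =
      (trivializationAt (EuclideanSpace ℝ (Fin d)) (TangentSpace I (M := M)) p ⟨q, v⟩).2 :=
  Trivialization.continuousLinearMapAt_apply_of_mem ℝ _ hq v

lemma ofCoord_apply (hq : q ∈ (chartAt H p).source) (v : EuclideanSpace ℝ (Fin d)) :
    ofCoord I p q v =
      (trivializationAt (EuclideanSpace ℝ (Fin d)) (TangentSpace I (M := M)) p).symm q v :=
  Trivialization.symmL_apply _ hq v

lemma toCoord_ofCoord (hq : q ∈ (chartAt H p).source) (v : EuclideanSpace ℝ (Fin d)) :
    toCoord I p q (ofCoord I p q v) = v :=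
  Trivialization.continuousLinearMapAt_symmL _ hq v

lemma ofCoord_toCoord (hq : q ∈ (chartAt H p).source) (v : TangentSpace I q) :
    ofCoord I p q (toCoord I p q v) = v :=
  Trivialization.symmL_continuousLinearMapAt _ hq v

lemma coordVector_eq (hq : q ∈ (chartAt H p).source) (i : Fin d) :
    coordVector I p q i = ofCoord I p q (EuclideanSpace.single i 1) :=
  (ofCoord_apply hq _).symm

lemma extend_eq (hq : q ∈ (chartAt H p).source) (v : TangentSpace I p) :
    FiberBundle.extend (EuclideanSpace ℝ (Fin d)) v q = ofCoord I p q (toCoord I p p v) := by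
  rw [ofCoord_apply hq, toCoord_apply (mem_chart_source H p)]
  rfl

/-- The coordinate frame, as a basis. -/
def coordBasis (hq : q ∈ (chartAt H p).source) : Module.Basis (Fin d) ℝ (TangentSpace I q) :=
  (EuclideanSpace.basisFun (Fin d) ℝ).toBasis.map
    (LinearEquiv.ofLinearMap (ofCoord I p q).toLinearMap (toCoord I p q).toLinearMap
      (LinearMap.ext fun v ↦ ofCoord_toCoord hq v) (LinearMap.ext fun v ↦ toCoord_ofCoord hq v))

lemma coe_coordBasis (hq : q ∈ (chartAt H p).source) :
    ⇑(coordBasis hq) = coordVector I p q := by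
  ext1 i
  rw [coordVector_eq hq]
  simp [coordBasis]

lemma coordBasis_repr (hq : q ∈ (chartAt H p).source) (v : TangentSpace I q) (i : Fin d) :
    (coordBasis hq).repr v i = toCoord I p q v i := by
  simp [coordBasis]

lemma sum_toCoord_smul (hq : q ∈ (chartAt H p).source) (v : TangentSpace I q) :
    v = ∑ i, toCoord I p q v i • coordVector I p q i := by
  have := (coordBasis hq).sum_repr v
  simp only [coordBasis_repr, coe_coordBasis] at this
  exact this.symm

/-- A scalar or vector function differentiated along a coordinate direction. -/
lemma mvfderiv_ofCoord {F : Type*} [NormedAddCommGroup F] [NormedSpace ℝ F] {h : M → F}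
    (hq : q ∈ (chartAt H p).source) (hh : MDifferentiableAt I 𝓘(ℝ, F) h q)
    (v : EuclideanSpace ℝ (Fin d)) :
    mvfderiv I h q (ofCoord I p q v) =
      fderivWithin ℝ (h ∘ (extChartAt I p).symm) (range I) (extChartAt I p q) v := by
  have hq' : q ∈ (extChartAt I p).source := by rwa [extChartAt_source]
  have ht : extChartAt I p q ∈ (extChartAt I p).target := (extChartAt I p).map_source hq'
  -- The coordinate frame is the differential of the inverse chart, so the claim is the chain rule.
  have h1 : ofCoord I p q = mfderivWithin 𝓘(ℝ, EuclideanSpace ℝ (Fin d)) I (extChartAt I p).symm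
      (range I) (extChartAt I p q) := TangentBundle.symmL_trivializationAt hq
  have hu : UniqueMDiffWithinAt 𝓘(ℝ, EuclideanSpace ℝ (Fin d)) (range I) (extChartAt I p q) :=
    (I.uniqueDiffOn _ (extChartAt_target_subset_range p ht)).uniqueMDiffWithinAt
  have hl : (extChartAt I p).symm (extChartAt I p q) = q := (extChartAt I p).left_inv hq'
  have h2 := mfderiv_comp_mfderivWithin_of_eq (I := 𝓘(ℝ, EuclideanSpace ℝ (Fin d))) (I' := I)
    (I'' := 𝓘(ℝ, F)) (g := h) (f := (extChartAt I p).symm) (s := range I)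
    (x := extChartAt I p q) (y := q) hh (mdifferentiableWithinAt_extChartAt_symm ht) hu hl
  have h3 := congrArg (fun L ↦ L v) h2
  rw [mfderivWithin_eq_fderivWithin] at h3
  rw [h1]
  exact h3.symm

end Coordinates

/-! ### Differentials of maps in charts -/

section CoordinatesOfMaps

variable {d : ℕ}
  {H₁ : Type*} [TopologicalSpace H₁] {I₁ : ModelWithCorners ℝ (EuclideanSpace ℝ (Fin d)) H₁}
  {M₁ : Type*} [TopologicalSpace M₁] [ChartedSpace H₁ M₁] [IsManifold I₁ 1 M₁]
  {H₂ : Type*} [TopologicalSpace H₂] {I₂ : ModelWithCorners ℝ (EuclideanSpace ℝ (Fin d)) H₂}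
  {M₂ : Type*} [TopologicalSpace M₂] [ChartedSpace H₂ M₂] [IsManifold I₂ 1 M₂]

/-- The coordinate expression of the differential of a map. -/
lemma toCoord_mfderiv_ofCoord {f : M₁ → M₂} {p q : M₁} {y : M₂} (hq : q ∈ (chartAt H₁ p).source)
    (hy : f q ∈ (chartAt H₂ y).source) (hf : MDifferentiableAt I₁ I₂ f q)
    (v : EuclideanSpace ℝ (Fin d)) :
    toCoord I₂ y (f q) (mfderiv I₁ I₂ f q (ofCoord I₁ p q v)) =
      fderivWithin ℝ (extChartAt I₂ y ∘ f ∘ (extChartAt I₁ p).symm) (range I₁)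
        (extChartAt I₁ p q) v := by
  have hc : MDifferentiableAt I₂ 𝓘(ℝ, EuclideanSpace ℝ (Fin d)) (extChartAt I₂ y) (f q) :=
    mdifferentiableAt_extChartAt hy
  have h1 : toCoord I₂ y (f q) = mfderiv I₂ 𝓘(ℝ, EuclideanSpace ℝ (Fin d)) (extChartAt I₂ y) (f q) :=
    TangentBundle.continuousLinearMapAt_trivializationAt hy
  have h2 := mvfderiv_ofCoord hq (hc.comp q hf) v
  rw [h1]
  rw [Function.comp_assoc] at h2
  refine Eq.trans ?_ h2
  exact (congrArg (fun L ↦ L (ofCoord I₁ p q v)) (mfderiv_comp q hc hf)).symm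

end CoordinatesOfMaps

/-! ### Smooth sections and the Riemannian density in charts -/

section Smooth

variable {d : ℕ}
  {H : Type*} [TopologicalSpace H] {I : ModelWithCorners ℝ (EuclideanSpace ℝ (Fin d)) H}
  {M : Type*} [TopologicalSpace M] [ChartedSpace H M] [IsManifold I ∞ M]
  {EN : Type*} [NormedAddCommGroup EN] [NormedSpace ℝ EN]
  {HN : Type*} [TopologicalSpace HN] {IN : ModelWithCorners ℝ EN HN}
  {N : Type*} [TopologicalSpace N] [ChartedSpace HN N]

/-- Smoothness of a section along a map can be read off in any chart. -/
lemma contMDiffAt_along_iff {b : N → M} {σ : ∀ n, TangentSpace I (b n)} {n₀ : N} {p : M}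
    (hp : b n₀ ∈ (chartAt H p).source) :
    ContMDiffAt IN I.tangent ∞ (fun n ↦ (⟨b n, σ n⟩ : TangentBundle I M)) n₀ ↔
      ContMDiffAt IN I ∞ b n₀ ∧
      ContMDiffAt IN 𝓘(ℝ, EuclideanSpace ℝ (Fin d)) ∞ (fun n ↦ toCoord I p (b n) (σ n)) n₀ := by
  have h := (trivializationAt (EuclideanSpace ℝ (Fin d)) (TangentSpace I (M := M)) p).contMDiffAt_iff
    (IM := IN) (IB := I) (n := ∞) (f := fun n ↦ (⟨b n, σ n⟩ : TangentBundle I M)) (x₀ := n₀) (by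
      rw [Trivialization.mem_source]; exact hp)
  refine h.trans (and_congr_right fun hb ↦ ?_)
  refine Filter.EventuallyEq.contMDiffAt_iff ?_
  filter_upwards [hb.continuousAt.preimage_mem_nhds ((chartAt H p).open_source.mem_nhds hp)]
    with n hn
  exact (toCoord_apply hn _).symm

lemma contMDiffAt_coordVector {p q : M} (hq : q ∈ (chartAt H p).source) (i : Fin d) :
    ContMDiffAt I I.tangent ∞ (fun q ↦ (⟨q, coordVector I p q i⟩ : TangentBundle I M)) q := by
  refine (contMDiffAt_along_iff (b := fun q ↦ q) hq).2 ⟨contMDiffAt_id, ?_⟩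
  refine (contMDiffAt_const (c := EuclideanSpace.single i (1 : ℝ))).congr_of_eventuallyEq ?_
  filter_upwards [(chartAt H p).open_source.mem_nhds hq] with x hx
  rw [coordVector_eq hx, toCoord_ofCoord hx]

lemma contMDiffAt_det {A : N → Matrix (Fin d) (Fin d) ℝ} {n₀ : N}
    (hA : ∀ i j, ContMDiffAt IN 𝓘(ℝ, ℝ) ∞ (fun n ↦ A n i j) n₀) :
    ContMDiffAt IN 𝓘(ℝ, ℝ) ∞ (fun n ↦ (A n).det) n₀ := by
  simp only [Matrix.det_apply']
  refine ContMDiffAt.sum fun τ _ ↦ ?_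
  exact contMDiffAt_const.mul (ContMDiffAt.prod fun i _ ↦ hA _ _)

variable [RiemannianBundle (fun x : M ↦ TangentSpace I x)]

/-- The Gram determinant `det (g_ij)` of the coordinate frame. -/
def gramDet (I : ModelWithCorners ℝ (EuclideanSpace ℝ (Fin d)) H) {M : Type*} [TopologicalSpace M]
    [ChartedSpace H M] [IsManifold I 1 M] [RiemannianBundle (fun x : M ↦ TangentSpace I x)]
    (p q : M) : ℝ :=
  Matrix.det (Matrix.of fun i j : Fin d ↦ inner ℝ (coordVector I p q i) (coordVector I p q j))

/-- The value of the Riemannian volume form on the coordinate frame. -/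
def coordVol (o : ManifoldOrientation I M) (p q : M) : ℝ :=
  (o.or q).volumeForm (coordVector I p q)

lemma coordVol_ne_zero (o : ManifoldOrientation I M) {p q : M}
    (hq : q ∈ (chartAt H p).source) :
    coordVol o p q ≠ 0 := by
  have := volumeForm_basis_ne_zero (o.or q) (coordBasis hq)
  rwa [coe_coordBasis] at this

lemma coordVol_sq (o : ManifoldOrientation I M) (p q : M) :
    coordVol o p q ^ 2 = gramDet I p q := volumeForm_sq _ _

/-- The Gram determinant is the square of a nonzero volume. Any orientation will do, so the one of
the coordinate frame is taken. -/
lemma gramDet_pos {p q : M} (hq : q ∈ (chartAt H p).source) : 0 < gramDet I p q := by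
  let o : Orientation ℝ (TangentSpace I q) (Fin d) := (coordBasis hq).orientation
  have h := volumeForm_basis_ne_zero o (coordBasis hq)
  rw [coe_coordBasis] at h
  have h2 : o.volumeForm (coordVector I p q) ^ 2 = gramDet I p q := volumeForm_sq _ _
  rw [← h2]
  positivity

/-- Turns the sign of the volume form into a comparison of orientations, which is the form in which
`ManifoldOrientation` provides local constancy. -/
lemma volumeForm_basis_pos_iff {V : Type*} [NormedAddCommGroup V] [InnerProductSpace ℝ V]
    [FiniteDimensional ℝ V] [hV : Fact (Module.finrank ℝ V = d)] [NeZero d]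
    (o : Orientation ℝ V (Fin d)) (b : Module.Basis (Fin d) ℝ V) :
    0 < o.volumeForm b ↔ b.orientation = o := by
  have hd : 0 < d := Nat.pos_of_ne_zero (NeZero.ne d)
  have he := o.finOrthonormalBasis_orientation hd hV.out
  rw [o.volumeForm_robust (o.finOrthonormalBasis hd hV.out) he,
    ← Module.Basis.orientation_eq_iff_det_pos, he]
  exact eq_comm

/-- Near the centre of a chart the volume form of the coordinate frame has a constant sign. -/
lemma eventually_coordVol_eq [NeZero d] (o : ManifoldOrientation I M) (p : M) :
    ∃ ε : ℝ, (ε = 1 ∨ ε = -1) ∧ ∀ᶠ q in 𝓝 p, coordVol o p q = ε * √(gramDet I p q) := by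
  obtain ⟨c, hc⟩ := o.locally_constant p
  let e₀ := (EuclideanSpace.basisFun (Fin d) ℝ).toBasis
  -- The trivialization carries the coordinate frame to the fixed basis e₀ and the orientation to c,
  -- so positivity at q becomes a condition that does not involve q.
  have key : ∀ᶠ q in 𝓝 p, q ∈ (chartAt H p).source ∧ (0 < coordVol o p q ↔ e₀.orientation = c) := by
    filter_upwards [hc, (chartAt H p).open_source.mem_nhds (mem_chart_source H p)] with q h1 hq
    refine ⟨hq, ?_⟩
    have h2 := h1 hq
    have h3 := volumeForm_basis_pos_iff (o.or q) (coordBasis hq)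
    rw [coe_coordBasis] at h3
    rw [coordVol, h3, ← h2]
    set L := ((trivializationAt (EuclideanSpace ℝ (Fin d)) (TangentSpace I (M := M))
            p).continuousLinearEquivAt ℝ q hq).toLinearEquiv
    have h4 : e₀ = (coordBasis hq).map L := by
      refine Module.Basis.eq_of_apply_eq fun i ↦ ?_
      rw [Module.Basis.map_apply, coe_coordBasis, coordVector_eq hq]
      refine Eq.trans ?_ ((toCoord_ofCoord hq _).symm.trans (toCoord_apply hq _))
      simp [e₀]
    rw [h4, Module.Basis.orientation_map]
    exact (Orientation.map (Fin d) L).injective.eq_iff.symm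
  by_cases h : e₀.orientation = c
  · refine ⟨1, Or.inl rfl, ?_⟩
    filter_upwards [key] with q hq
    rw [← coordVol_sq o, one_mul, Real.sqrt_sq (hq.2.2 h).le]
  · refine ⟨-1, Or.inr rfl, ?_⟩
    filter_upwards [key] with q hq
    have : coordVol o p q ≤ 0 := not_lt.1 fun h' ↦ h (hq.2.1 h')
    rw [← coordVol_sq o, Real.sqrt_sq_eq_abs, abs_of_nonpos this]
    ring

variable
  [IsContMDiffRiemannianBundle I ∞ (EuclideanSpace ℝ (Fin d)) (fun x : M ↦ TangentSpace I x)]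

lemma contMDiffAt_gramDet {p q : M} (hq : q ∈ (chartAt H p).source) :
    ContMDiffAt I 𝓘(ℝ, ℝ) ∞ (gramDet I p) q :=
  contMDiffAt_det fun i j ↦
    ContMDiffAt.inner_bundle (IB := I) (F := EuclideanSpace ℝ (Fin d))
      (E := fun x : M ↦ TangentSpace I x) (b := fun x ↦ x)
      (contMDiffAt_coordVector hq i) (contMDiffAt_coordVector hq j)

/-- At the centre of a chart the signed density is a constant sign times √(det g), hence smooth.
Since `locally_constant` only speaks about neighbourhoods of the centre, at another point q the
frame is compared with that of the chart centred at q, through a smooth transition determinant. -/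
lemma contMDiffAt_coordVol [NeZero d] (o : ManifoldOrientation I M) {p q : M}
    (hq : q ∈ (chartAt H p).source) : ContMDiffAt I 𝓘(ℝ, ℝ) ∞ (coordVol o p) q := by
  have h1 : ContMDiffAt I 𝓘(ℝ, ℝ) ∞ (coordVol o q) q := by
    obtain ⟨ε, -, h⟩ := eventually_coordVol_eq o q
    refine ContMDiffAt.congr_of_eventuallyEq ?_ h
    refine contMDiffAt_const.mul ?_
    have hs : ContDiffAt ℝ ∞ Real.sqrt (gramDet I q q) :=
      Real.contDiffAt_sqrt (gramDet_pos (mem_chart_source H q)).ne'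
    exact hs.contMDiffAt.comp q (contMDiffAt_gramDet (mem_chart_source H q))
  have h2 : coordVol o p =ᶠ[𝓝 q] fun x ↦ (Matrix.of fun i j : Fin d ↦
      toCoord I q x (coordVector I p x j) i).det * coordVol o q x := by
    filter_upwards [(chartAt H q).open_source.mem_nhds (mem_chart_source H q)] with x hx
    have := volumeForm_eq_det_mul (o.or x) (coordBasis hx) (coordVector I p x)
    rw [coe_coordBasis] at this
    rw [coordVol, this, Module.Basis.det_apply]
    congr 2
  refine ContMDiffAt.congr_of_eventuallyEq ?_ h2
  refine (contMDiffAt_det fun i j ↦ ?_).mul h1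
  have h3 := ((contMDiffAt_along_iff (I := I) (b := fun q ↦ q) (mem_chart_source H q)).1
    (contMDiffAt_coordVector hq j)).2
  have h4 : ContDiff ℝ ∞ (fun v : EuclideanSpace ℝ (Fin d) ↦ v i) := by fun_prop
  exact h4.contMDiff.contMDiffAt.comp q h3

end Smooth

/-! ### The Levi-Civita connection in coordinates -/

local instance instNormedAddCommGroupModel (d : ℕ) : NormedAddCommGroup (EuclideanSpace ℝ (Fin d)) :=
  inferInstance

local instance instNormedSpaceModel (d : ℕ) : NormedSpace ℝ (EuclideanSpace ℝ (Fin d)) :=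
  inferInstance

local instance instNormedAddCommGroupModelDual (d : ℕ) :
    NormedAddCommGroup (EuclideanSpace ℝ (Fin d) →L[ℝ] ℝ) :=
  inferInstance

local instance instNormedSpaceModelDual (d : ℕ) : NormedSpace ℝ (EuclideanSpace ℝ (Fin d) →L[ℝ] ℝ) :=
  inferInstance

local instance instNormedAddCommGroupModelBilinear (d : ℕ) :
    NormedAddCommGroup (EuclideanSpace ℝ (Fin d) →L[ℝ] EuclideanSpace ℝ (Fin d) →L[ℝ] ℝ) :=
  inferInstance

local instance instNormedSpaceModelBilinear (d : ℕ) :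
    NormedSpace ℝ (EuclideanSpace ℝ (Fin d) →L[ℝ] EuclideanSpace ℝ (Fin d) →L[ℝ] ℝ) :=
  inferInstance

/-! ### Vector fields, brackets and the metric read in a chart -/

section ChartCalculus

variable {d : ℕ}
  {H : Type*} [TopologicalSpace H] {I : ModelWithCorners ℝ (EuclideanSpace ℝ (Fin d)) H}
  {M : Type*} [TopologicalSpace M] [ChartedSpace H M]

lemma symm_mem_source {p : M} {x : EuclideanSpace ℝ (Fin d)} (hx : x ∈ (extChartAt I p).target) :
    (extChartAt I p).symm x ∈ (chartAt H p).source := by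
  rw [← extChartAt_source I]
  exact (extChartAt I p).map_target hx

lemma eventually_mem_target {p q : M} (hq : q ∈ (chartAt H p).source) :
    ∀ᶠ x in 𝓝[range I] (extChartAt I p q), x ∈ (extChartAt I p).target :=
  extChartAt_target_mem_nhdsWithin_of_mem
    ((extChartAt I p).map_source (by rwa [extChartAt_source]))

lemma extChartAt_symm_apply {p q : M} (hq : q ∈ (chartAt H p).source) :
    (extChartAt I p).symm (extChartAt I p q) = q :=
  (extChartAt I p).left_inv (by rwa [extChartAt_source])

lemma extChartAt_mem_range (p q : M) : extChartAt I p q ∈ range I := by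
  rw [extChartAt_coe]
  exact mem_range_self _

lemma uniqueDiffWithinAt_extChartAt (p q : M) :
    UniqueDiffWithinAt ℝ (range I) (extChartAt I p q) :=
  I.uniqueDiffOn _ (extChartAt_mem_range p q)

variable [IsManifold I ∞ M]

lemma contDiffWithinAt_comp_symm {F : Type*} [NormedAddCommGroup F] [NormedSpace ℝ F] {h : M → F}
    {p q : M} (hq : q ∈ (chartAt H p).source) (hh : ContMDiffAt I 𝓘(ℝ, F) ∞ h q) :
    ContDiffWithinAt ℝ ∞ (h ∘ (extChartAt I p).symm) (range I) (extChartAt I p q) :=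
  ((contMDiffAt_iff_source_of_mem_source hq).1 hh).contDiffWithinAt

/-- The coordinates of a vector field in the chart around `p`, as a map on the model space. -/
def fieldCoord (I : ModelWithCorners ℝ (EuclideanSpace ℝ (Fin d)) H) {M : Type*}
    [TopologicalSpace M] [ChartedSpace H M] [IsManifold I 1 M] (p : M)
    (X : ∀ q : M, TangentSpace I q) (x : EuclideanSpace ℝ (Fin d)) : EuclideanSpace ℝ (Fin d) :=
  toCoord I p ((extChartAt I p).symm x) (X ((extChartAt I p).symm x))

lemma fieldCoord_extChartAt {p q : M} (hq : q ∈ (chartAt H p).source)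
    (X : ∀ q : M, TangentSpace I q) :
    fieldCoord I p X (extChartAt I p q) = toCoord I p q (X q) := by
  rw [fieldCoord, extChartAt_symm_apply hq]

lemma contDiffWithinAt_fieldCoord {p q : M} (hq : q ∈ (chartAt H p).source)
    {X : ∀ q : M, TangentSpace I q}
    (hX : ContMDiffAt I I.tangent ∞ (fun q ↦ (⟨q, X q⟩ : TangentBundle I M)) q) :
    ContDiffWithinAt ℝ ∞ (fieldCoord I p X) (range I) (extChartAt I p q) :=
  contDiffWithinAt_comp_symm hq ((contMDiffAt_along_iff (b := fun q ↦ q) hq).1 hX).2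

lemma contMDiffAt_extend {p : M} (v : TangentSpace I p) :
    ContMDiffAt I I.tangent ∞ (fun q ↦ (⟨q, FiberBundle.extend (EuclideanSpace ℝ (Fin d)) v q⟩ :
      TangentBundle I M)) p := by
  refine (contMDiffAt_along_iff (b := fun q ↦ q) (mem_chart_source H p)).2 ⟨contMDiffAt_id, ?_⟩
  refine (contMDiffAt_const (c := toCoord I p p v)).congr_of_eventuallyEq ?_
  filter_upwards [(chartAt H p).open_source.mem_nhds (mem_chart_source H p)] with q hq
  rw [extend_eq hq, toCoord_ofCoord hq]

/-- `FiberBundle.extend` is constant in the chart frame; this is what collapses the Koszul formula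
in `koszul_extend`. -/
lemma fderivWithin_fieldCoord_extend {p : M} (v : TangentSpace I p) :
    fderivWithin ℝ (fieldCoord I p (FiberBundle.extend (EuclideanSpace ℝ (Fin d)) v)) (range I)
      (extChartAt I p p) = 0 := by
  have h : fieldCoord I p (FiberBundle.extend (EuclideanSpace ℝ (Fin d)) v)
      =ᶠ[𝓝[range I] (extChartAt I p p)] fun _ ↦ toCoord I p p v := by
    filter_upwards [eventually_mem_target (mem_chart_source H p)] with x hx
    rw [fieldCoord, extend_eq (symm_mem_source hx), toCoord_ofCoord (symm_mem_source hx)]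
  rw [h.fderivWithin_eq_of_mem (extChartAt_mem_range p p), fderivWithin_fun_const]
  rfl

/-- The Lie bracket in the chart around the base point. -/
lemma mlieBracket_eq (V W : ∀ q : M, TangentSpace I q) (p : M) :
    VectorField.mlieBracket I V W p = ofCoord I p p
      (fderivWithin ℝ (fieldCoord I p W) (range I) (extChartAt I p p) (toCoord I p p (V p)) -
        fderivWithin ℝ (fieldCoord I p V) (range I) (extChartAt I p p) (toCoord I p p (W p))) := by
  -- Pulling a field back by the inverse chart amounts to taking its coordinates, since `ofCoord`
  -- and `toCoord` are mutually inverse.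
  have key : ∀ V : ∀ q : M, TangentSpace I q,
      VectorField.mpullbackWithin 𝓘(ℝ, EuclideanSpace ℝ (Fin d)) I (extChartAt I p).symm V (range I)
        =ᶠ[𝓝[range I] (extChartAt I p p)] fieldCoord I p V := by
    intro V
    filter_upwards [eventually_mem_target (mem_chart_source H p)] with x hx
    have hs := symm_mem_source hx
    have h1 : ofCoord I p ((extChartAt I p).symm x) =
        mfderivWithin 𝓘(ℝ, EuclideanSpace ℝ (Fin d)) I (extChartAt I p).symm (range I) x := by
      have := TangentBundle.symmL_trivializationAt (I := I) hs
      rw [(extChartAt I p).right_inv hx] at this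
      exact this
    have h2 : (ofCoord I p ((extChartAt I p).symm x)).inverse =
        toCoord I p ((extChartAt I p).symm x) :=
      ContinuousLinearMap.inverse_eq
        (ContinuousLinearMap.ext fun v ↦ ofCoord_toCoord hs v)
        (ContinuousLinearMap.ext fun v ↦ toCoord_ofCoord hs v)
    rw [fieldCoord, ← h2, h1]
    rfl
  have h3 : (mfderiv I 𝓘(ℝ, EuclideanSpace ℝ (Fin d)) (extChartAt I p) p).inverse =
      ofCoord I p p := by
    have h1 : toCoord I p p = mfderiv I 𝓘(ℝ, EuclideanSpace ℝ (Fin d)) (extChartAt I p) p :=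
      TangentBundle.continuousLinearMapAt_trivializationAt (mem_chart_source H p)
    rw [← h1]
    exact ContinuousLinearMap.inverse_eq
        (ContinuousLinearMap.ext fun v ↦ toCoord_ofCoord (mem_chart_source H p) v)
        (ContinuousLinearMap.ext fun v ↦ ofCoord_toCoord (mem_chart_source H p) v)
  rw [← VectorField.mlieBracketWithin_univ, VectorField.mlieBracketWithin_apply, h3,
    preimage_univ, univ_inter]
  have hm := extChartAt_mem_range (I := I) p p
  rw [(key V).lieBracketWithin_vectorField_eq_of_mem (key W) hm, VectorField.lieBracketWithin_eq,
    ← fieldCoord_extChartAt (mem_chart_source H p), ← fieldCoord_extChartAt (mem_chart_source H p)]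
  rfl

variable [RiemannianBundle (fun x : M ↦ TangentSpace I x)]

/-- The metric in the chart around `p`, as a map from the model space to bilinear forms. -/
def metricCoord (I : ModelWithCorners ℝ (EuclideanSpace ℝ (Fin d)) H) {M : Type*}
    [TopologicalSpace M] [ChartedSpace H M] [IsManifold I 1 M]
    [RiemannianBundle (fun x : M ↦ TangentSpace I x)] (p : M) (x : EuclideanSpace ℝ (Fin d)) :
    EuclideanSpace ℝ (Fin d) →L[ℝ] EuclideanSpace ℝ (Fin d) →L[ℝ] ℝ :=
  ∑ i, ∑ j, (inner ℝ (coordVector I p ((extChartAt I p).symm x) i)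
      (coordVector I p ((extChartAt I p).symm x) j) : ℝ) •
    (EuclideanSpace.proj i : EuclideanSpace ℝ (Fin d) →L[ℝ] ℝ).smulRight
      (EuclideanSpace.proj j : EuclideanSpace ℝ (Fin d) →L[ℝ] ℝ)

lemma metricCoord_apply {p : M} {x : EuclideanSpace ℝ (Fin d)} (hx : x ∈ (extChartAt I p).target)
    (a b : EuclideanSpace ℝ (Fin d)) :
    metricCoord I p x a b = inner ℝ (ofCoord I p ((extChartAt I p).symm x) a)
      (ofCoord I p ((extChartAt I p).symm x) b) := by
  have hs := symm_mem_source hx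
  conv_rhs => rw [sum_toCoord_smul hs (ofCoord I p ((extChartAt I p).symm x) a),
    sum_toCoord_smul hs (ofCoord I p ((extChartAt I p).symm x) b)]
  simp only [sum_inner, inner_sum, real_inner_smul_left, real_inner_smul_right,
    toCoord_ofCoord hs, metricCoord, sum_apply, smul_apply, ContinuousLinearMap.smulRight_apply,
    PiLp.proj_apply, smul_eq_mul]
  rw [Finset.sum_comm]
  exact Finset.sum_congr rfl fun i _ ↦ Finset.sum_congr rfl fun j _ ↦ by ring

lemma inner_eq_metricCoord {p : M} {x : EuclideanSpace ℝ (Fin d)}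
    (hx : x ∈ (extChartAt I p).target) (X Y : ∀ q : M, TangentSpace I q) :
    (inner ℝ (X ((extChartAt I p).symm x)) (Y ((extChartAt I p).symm x)) : ℝ) =
      metricCoord I p x (fieldCoord I p X x) (fieldCoord I p Y x) := by
  rw [metricCoord_apply hx, fieldCoord, fieldCoord, ofCoord_toCoord (symm_mem_source hx),
    ofCoord_toCoord (symm_mem_source hx)]

lemma metricCoord_self {p : M} (u v : TangentSpace I p) :
    metricCoord I p (extChartAt I p p) (toCoord I p p u) (toCoord I p p v) = inner ℝ u v := by
  rw [metricCoord_apply (mem_extChartAt_target p), extChartAt_to_inv,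
    ofCoord_toCoord (mem_chart_source H p), ofCoord_toCoord (mem_chart_source H p)]

variable [IsContMDiffRiemannianBundle I ∞ (EuclideanSpace ℝ (Fin d))
  (fun x : M ↦ TangentSpace I x)]

lemma contMDiffAt_inner {X Y : ∀ q : M, TangentSpace I q} {p : M}
    (hX : ContMDiffAt I I.tangent ∞ (fun q ↦ (⟨q, X q⟩ : TangentBundle I M)) p)
    (hY : ContMDiffAt I I.tangent ∞ (fun q ↦ (⟨q, Y q⟩ : TangentBundle I M)) p) :
    ContMDiffAt I 𝓘(ℝ, ℝ) ∞ (fun q ↦ (inner ℝ (X q) (Y q) : ℝ)) p :=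
  ContMDiffAt.inner_bundle (IB := I) (F := EuclideanSpace ℝ (Fin d))
    (E := fun x : M ↦ TangentSpace I x) (b := fun x ↦ x) hX hY

lemma differentiableWithinAt_sum_smul {E F ι : Type*} [NormedAddCommGroup E] [NormedSpace ℝ E]
    [NormedAddCommGroup F] [NormedSpace ℝ F] [Fintype ι] {c : ι → ι → E → ℝ} (k : ι → ι → F)
    {s : Set E} {x : E} (hc : ∀ i j, DifferentiableWithinAt ℝ (c i j) s x) :
    DifferentiableWithinAt ℝ (fun y ↦ ∑ i, ∑ j, c i j y • k i j) s x :=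
  DifferentiableWithinAt.fun_sum fun i _ ↦ DifferentiableWithinAt.fun_sum fun j _ ↦
    (hc i j).smul_const (k i j)

set_option synthInstance.maxHeartbeats 200000 in
lemma differentiableWithinAt_metricCoord (p : M) :
    DifferentiableWithinAt ℝ (metricCoord I p) (range I) (extChartAt I p p) :=
  differentiableWithinAt_sum_smul _ fun i j ↦
    (contDiffWithinAt_comp_symm (mem_chart_source H p)
      (contMDiffAt_inner (contMDiffAt_coordVector (mem_chart_source H p) i)
        (contMDiffAt_coordVector (mem_chart_source H p) j))).differentiableWithinAt (by simp)

/-- The product rule for the metric. -/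
lemma mvfderiv_inner {X Y : ∀ q : M, TangentSpace I q} {p : M}
    (hX : ContMDiffAt I I.tangent ∞ (fun q ↦ (⟨q, X q⟩ : TangentBundle I M)) p)
    (hY : ContMDiffAt I I.tangent ∞ (fun q ↦ (⟨q, Y q⟩ : TangentBundle I M)) p)
    (u : TangentSpace I p) :
    mvfderiv I (fun q ↦ (inner ℝ (X q) (Y q) : ℝ)) p u =
      fderivWithin ℝ (metricCoord I p) (range I) (extChartAt I p p) (toCoord I p p u)
        (toCoord I p p (X p)) (toCoord I p p (Y p)) +
      metricCoord I p (extChartAt I p p) (fderivWithin ℝ (fieldCoord I p X) (range I)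
        (extChartAt I p p) (toCoord I p p u)) (toCoord I p p (Y p)) +
      metricCoord I p (extChartAt I p p) (toCoord I p p (X p)) (fderivWithin ℝ (fieldCoord I p Y)
        (range I) (extChartAt I p p) (toCoord I p p u)) := by
  have hp := mem_chart_source H p
  conv_lhs => rw [← ofCoord_toCoord hp u]
  rw [mvfderiv_ofCoord hp ((contMDiffAt_inner hX hY).mdifferentiableAt (by simp))]
  have he : (fun q ↦ (inner ℝ (X q) (Y q) : ℝ)) ∘ (extChartAt I p).symm
      =ᶠ[𝓝[range I] (extChartAt I p p)]
      fun x ↦ metricCoord I p x (fieldCoord I p X x) (fieldCoord I p Y x) := by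
    filter_upwards [eventually_mem_target hp] with x hx
    exact inner_eq_metricCoord hx X Y
  have hXd := ((contDiffWithinAt_fieldCoord hp hX).differentiableWithinAt
    (by simp)).hasFDerivWithinAt
  have hYd := ((contDiffWithinAt_fieldCoord hp hY).differentiableWithinAt
    (by simp)).hasFDerivWithinAt
  have hG := (differentiableWithinAt_metricCoord (I := I) p).hasFDerivWithinAt
  rw [he.fderivWithin_eq_of_mem (extChartAt_mem_range p p),
    ((hG.clm_apply hXd).clm_apply hYd).fderivWithin (uniqueDiffWithinAt_extChartAt p p)]
  simp only [fieldCoord_extChartAt hp, add_apply, ContinuousLinearMap.comp_apply,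
    ContinuousLinearMap.flip_apply]
  ring

/-- The Koszul expression for locally constant fields `u`, `w`. -/
lemma koszul_extend {X : ∀ q : M, TangentSpace I q} {p : M}
    (hX : ContMDiffAt I I.tangent ∞ (fun q ↦ (⟨q, X q⟩ : TangentBundle I M)) p)
    (u w : TangentSpace I p) :
    koszul I (FiberBundle.extend (EuclideanSpace ℝ (Fin d)) u) X
        (FiberBundle.extend (EuclideanSpace ℝ (Fin d)) w) p =
      fderivWithin ℝ (metricCoord I p) (range I) (extChartAt I p p) (toCoord I p p u)
        (toCoord I p p (X p)) (toCoord I p p w) +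
      fderivWithin ℝ (metricCoord I p) (range I) (extChartAt I p p) (toCoord I p p (X p))
        (toCoord I p p u) (toCoord I p p w) -
      fderivWithin ℝ (metricCoord I p) (range I) (extChartAt I p p) (toCoord I p p w)
        (toCoord I p p u) (toCoord I p p (X p)) +
      2 * inner ℝ (ofCoord I p p (fderivWithin ℝ (fieldCoord I p X) (range I)
        (extChartAt I p p) (toCoord I p p u))) w := by
  have hp := mem_chart_source H p
  have hm : ∀ (a : EuclideanSpace ℝ (Fin d)) (v : TangentSpace I p),
      metricCoord I p (extChartAt I p p) a (toCoord I p p v) = inner ℝ (ofCoord I p p a) v := by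
    intro a v
    rw [← metricCoord_self, toCoord_ofCoord hp]
  have hm' : ∀ (a : EuclideanSpace ℝ (Fin d)) (v : TangentSpace I p),
      metricCoord I p (extChartAt I p p) (toCoord I p p v) a = inner ℝ v (ofCoord I p p a) := by
    intro a v
    rw [← metricCoord_self, toCoord_ofCoord hp]
  rw [koszul, mvfderiv_inner hX (contMDiffAt_extend w),
    mvfderiv_inner (contMDiffAt_extend u) (contMDiffAt_extend w),
    mvfderiv_inner (contMDiffAt_extend u) hX, mlieBracket_eq, mlieBracket_eq, mlieBracket_eq]
  -- The extensions of u and w have zero derivative and zero bracket. The two terms with the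
  -- derivative of X along w cancel, and the two along u add up to the factor 2.
  simp only [fderivWithin_fieldCoord_extend, FiberBundle.extend_apply_self, zero_apply, map_zero,
    sub_zero, zero_sub, map_neg, inner_neg_left, inner_zero_left, inner_zero_right, hm, hm', add_zero]
  rw [real_inner_comm u]
  ring

end ChartCalculus

/-! ### Covariant derivative, volume density and divergence in coordinates -/

section LeviCivita

variable {d : ℕ}
  {H : Type*} [TopologicalSpace H] {I : ModelWithCorners ℝ (EuclideanSpace ℝ (Fin d)) H}
  {M : Type*} [TopologicalSpace M] [ChartedSpace H M] [IsManifold I ∞ M]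
  [RiemannianBundle (fun x : M ↦ TangentSpace I x)]
  [IsContMDiffRiemannianBundle I ∞ (EuclideanSpace ℝ (Fin d)) (fun x : M ↦ TangentSpace I x)]

lemma hasFDerivWithinAt_metricCoord_apply (p : M) (a b : EuclideanSpace ℝ (Fin d)) :
    HasFDerivWithinAt (fun x ↦ metricCoord I p x a b)
      (((fderivWithin ℝ (metricCoord I p) (range I) (extChartAt I p p)).flip a).flip b) (range I)
      (extChartAt I p p) := by
  have hG := (differentiableWithinAt_metricCoord (I := I) p).hasFDerivWithinAt
  have := (hG.clm_apply (hasFDerivWithinAt_const a (extChartAt I p p) (range I))).clm_apply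
    (hasFDerivWithinAt_const b (extChartAt I p p) (range I))
  refine this.congr_fderiv ?_
  ext v
  simp only [add_apply, ContinuousLinearMap.comp_apply, ContinuousLinearMap.flip_apply, zero_apply,
    map_zero, zero_add]

lemma fderivWithin_metricCoord_comm (p : M) (v a b : EuclideanSpace ℝ (Fin d)) :
    fderivWithin ℝ (metricCoord I p) (range I) (extChartAt I p p) v a b =
      fderivWithin ℝ (metricCoord I p) (range I) (extChartAt I p p) v b a := by
  have h : (fun x ↦ metricCoord I p x a b) = fun x ↦ metricCoord I p x b a := by
    ext x
    simp only [metricCoord, sum_apply, smul_apply, ContinuousLinearMap.smulRight_apply,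
      PiLp.proj_apply, smul_eq_mul]
    rw [Finset.sum_comm]
    refine Finset.sum_congr rfl fun i _ ↦ Finset.sum_congr rfl fun j _ ↦ ?_
    rw [real_inner_comm]
    ring
  have h1 := hasFDerivWithinAt_metricCoord_apply (I := I) p a b
  rw [h] at h1
  exact congrArg (fun L : EuclideanSpace ℝ (Fin d) →L[ℝ] ℝ ↦ L v)
    ((uniqueDiffWithinAt_extChartAt p p).eq h1 (hasFDerivWithinAt_metricCoord_apply p b a))

/-- The covariant derivative is the derivative of the coordinates plus a zeroth-order term. -/
lemma leviCivita_eq {X : ∀ q : M, TangentSpace I q} {p : M}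
    (hX : ContMDiffAt I I.tangent ∞ (fun q ↦ (⟨q, X q⟩ : TangentBundle I M)) p)
    (u : TangentSpace I p) :
    leviCivita I X p u = ofCoord I p p (fderivWithin ℝ (fieldCoord I p X) (range I)
        (extChartAt I p p) (toCoord I p p u)) +
      leviCivita I (FiberBundle.extend (EuclideanSpace ℝ (Fin d)) (X p)) p u := by
  rw [leviCivita, leviCivita]
  conv_rhs => enter [1]; rw [← (stdOrthonormalBasis ℝ (TangentSpace I p)).sum_repr'
    (ofCoord I p p (fderivWithin ℝ (fieldCoord I p X) (range I)
        (extChartAt I p p) (toCoord I p p u)))]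
  rw [← Finset.sum_add_distrib]
  refine Finset.sum_congr rfl fun k _ ↦ ?_
  rw [koszul_extend hX, koszul_extend (contMDiffAt_extend (X p)), ← add_smul]
  congr 1
  simp only [fderivWithin_fieldCoord_extend, FiberBundle.extend_apply_self, zero_apply, map_zero,
    inner_zero_left]
  rw [real_inner_comm]
  ring

/-- The covariant derivative is linear in the direction. -/
lemma exists_linear_leviCivita {X : ∀ q : M, TangentSpace I q} {p : M}
    (hX : ContMDiffAt I I.tangent ∞ (fun q ↦ (⟨q, X q⟩ : TangentBundle I M)) p) :
    ∃ L : TangentSpace I p →ₗ[ℝ] TangentSpace I p, ∀ u, leviCivita I X p u = L u := by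
  refine ⟨{ toFun := leviCivita I X p, map_add' := fun u v ↦ ?_, map_smul' := fun c u ↦ ?_ },
    fun u ↦ rfl⟩
  · simp only [leviCivita, koszul_extend hX, ← Finset.sum_add_distrib, ← add_smul]
    refine Finset.sum_congr rfl fun k _ ↦ ?_
    congr 1
    simp only [map_add, add_apply, inner_add_left]
    ring
  · simp only [leviCivita, koszul_extend hX, Finset.smul_sum, smul_smul]
    refine Finset.sum_congr rfl fun k _ ↦ ?_
    congr 1
    simp only [map_smul, smul_apply, real_inner_smul_left, RingHom.id_apply, smul_eq_mul]
    ring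

/-- The logarithmic derivative of the volume density is half the trace of the derivative of the
metric. -/
lemma fderivWithin_coordVol [NeZero d] (o : ManifoldOrientation I M) (p : M)
    (s : EuclideanSpace ℝ (Fin d)) :
    fderivWithin ℝ (coordVol o p ∘ (extChartAt I p).symm) (range I) (extChartAt I p p) s =
      coordVol o p p * ∑ k, 1 / 2 * fderivWithin ℝ (metricCoord I p) (range I) (extChartAt I p p) s
        (toCoord I p p (stdFrame d (TangentSpace I p) k))
        (toCoord I p p (stdFrame d (TangentSpace I p) k)) := by
  have hp := mem_chart_source H p
  set x₀ := extChartAt I p p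
  -- An orthonormal basis at p, with its coordinates frozen over the chart. Its Gram matrix is the
  -- identity at x₀, so there the derivative of the Gram determinant is a trace.
  set c : Fin d → EuclideanSpace ℝ (Fin d) := fun k ↦
    toCoord I p p (stdFrame d (TangentSpace I p) k) with hc
  set e₀ := (EuclideanSpace.basisFun (Fin d) ℝ).toBasis
  have hu := uniqueDiffWithinAt_extChartAt (I := I) p p
  have hU : ∀ q ∈ (chartAt H p).source,
      (o.or q).volumeForm (fun k ↦ ofCoord I p q (c k)) = e₀.det c * coordVol o p q := by
    intro q hq
    have h1 := ((o.or q).volumeForm.compLinearMap (ofCoord I p q).toLinearMap).eq_smul_basis_det e₀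
    have h2 := congrArg (fun α : EuclideanSpace ℝ (Fin d) [⋀^Fin d]→ₗ[ℝ] ℝ ↦ α c) h1
    simp only [AlternatingMap.compLinearMap_apply, AlternatingMap.smul_apply, smul_eq_mul,
      ContinuousLinearMap.coe_coe] at h2
    rw [h2, mul_comm, coordVol]
    congr 2
    ext1 i
    rw [coordVector_eq hq]
    simp [e₀]
  have hgram : ∀ x ∈ (extChartAt I p).target,
      (e₀.det c * coordVol o p ((extChartAt I p).symm x)) ^ 2 =
        Matrix.detRowAlternating fun k l ↦ metricCoord I p x (c k) (c l) := by
    intro x hx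
    rw [← hU _ (symm_mem_source hx), volumeForm_sq]
    refine congrArg Matrix.det ?_
    ext k l
    rw [Matrix.of_apply, metricCoord_apply hx]
  have hrow : ∀ k, HasFDerivWithinAt (fun x l ↦ metricCoord I p x (c k) (c l))
      (ContinuousLinearMap.pi fun l ↦ ((fderivWithin ℝ (metricCoord I p) (range I) x₀).flip
        (c k)).flip (c l)) (range I) x₀ := by
    intro k
    rw [hasFDerivWithinAt_pi]
    intro l
    exact hasFDerivWithinAt_metricCoord_apply p (c k) (c l)
  obtain ⟨D, hD, hDv⟩ := hasFDerivWithinAt_alternating (Pi.basisFun ℝ (Fin d))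
    Matrix.detRowAlternating hrow
  have hone : (fun k l ↦ metricCoord I p x₀ (c k) (c l)) = ⇑(Pi.basisFun ℝ (Fin d)) := by
    ext k l
    rw [hc, metricCoord_self, OrthonormalBasis.inner_eq_ite]
    simp [Pi.single_apply, eq_comm]
  have hdet1 : Matrix.detRowAlternating ⇑(Pi.basisFun ℝ (Fin d)) = (1 : ℝ) := by
    have : Matrix.of ⇑(Pi.basisFun ℝ (Fin d)) = 1 := by
      ext k l
      simp [Matrix.one_apply, Pi.single_apply, eq_comm]
    exact (congrArg Matrix.det this).trans Matrix.det_one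
  have hDs : D s = ∑ k, fderivWithin ℝ (metricCoord I p) (range I) x₀ s (c k) (c k) := by
    rw [hDv, hone]
    refine Finset.sum_congr rfl fun k _ ↦ ?_
    rw [alternating_update_basis, hdet1]
    simp
  have hW : DifferentiableWithinAt ℝ (coordVol o p ∘ (extChartAt I p).symm) (range I) x₀ :=
    (contDiffWithinAt_comp_symm hp (contMDiffAt_coordVol o hp)).differentiableWithinAt (by simp)
  -- The density is differentiated through its square, which is the Gram determinant; since that
  -- square is 1 at p, the resulting equation can be solved for the derivative of the density
  -- itself.
  have hsq := (hW.hasFDerivWithinAt.const_mul (e₀.det c)).pow 2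
  have hsq' : HasFDerivWithinAt
      (fun x ↦ (e₀.det c * coordVol o p ((extChartAt I p).symm x)) ^ 2) D (range I) x₀ := by
    refine hD.congr_of_eventuallyEq ?_ (hgram _ (mem_extChartAt_target p))
    filter_upwards [eventually_mem_target hp] with x hx
    exact hgram x hx
  have heq := congrArg (fun L : EuclideanSpace ℝ (Fin d) →L[ℝ] ℝ ↦ L s) (hu.eq hsq hsq')
  have hval : (e₀.det c * coordVol o p p) ^ 2 = 1 := by
    have := hgram _ (mem_extChartAt_target (I := I) p)
    rw [hone, hdet1, extChartAt_to_inv] at this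
    exact this
  have hx : (extChartAt I p).symm x₀ = p := extChartAt_to_inv p
  simp only [smul_apply, smul_eq_mul, Function.comp_apply, hx, hDs] at heq
  rw [← Finset.mul_sum, ← heq]
  set δ := e₀.det c
  set w := coordVol o p p
  set y := fderivWithin ℝ (coordVol o p ∘ (extChartAt I p).symm) (range I) x₀ s
  simp only [Nat.add_one_sub_one, pow_one]
  linear_combination (-y) * hval

/-- The divergence in the chart around the base point. -/
lemma divergence_eq [NeZero d] (o : ManifoldOrientation I M) {X : ∀ q : M, TangentSpace I q} {p : M}
    (hX : ContMDiffAt I I.tangent ∞ (fun q ↦ (⟨q, X q⟩ : TangentBundle I M)) p) :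
    coordVol o p p * divergence I X p =
      coordVol o p p * ∑ i, fderivWithin ℝ (fieldCoord I p X) (range I) (extChartAt I p p)
        (EuclideanSpace.single i 1) i +
      fderivWithin ℝ (coordVol o p ∘ (extChartAt I p).symm) (range I) (extChartAt I p p)
        (toCoord I p p (X p)) := by
  have hp := mem_chart_source H p
  set X' := fderivWithin ℝ (fieldCoord I p X) (range I) (extChartAt I p p)
  -- In the Koszul expression with u = w = e_k, two of the three metric derivatives cancel by
  -- symmetry of the metric. What remains is half the derivative along X, the term that
  -- `fderivWithin_coordVol` identifies with the density.
  have h1 : divergence I X p = ∑ k, (1 / 2 * fderivWithin ℝ (metricCoord I p) (range I)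
        (extChartAt I p p) (toCoord I p p (X p))
        (toCoord I p p (stdFrame d (TangentSpace I p) k))
        (toCoord I p p (stdFrame d (TangentSpace I p) k))) +
      LinearMap.trace ℝ (TangentSpace I p)
        ((ofCoord I p p).toLinearMap ∘ₗ X'.toLinearMap ∘ₗ (toCoord I p p).toLinearMap) := by
    rw [trace_eq_sum_inner, ← sum_stdOrthonormalBasis (d := d) (fun e : TangentSpace I p ↦
      1 / 2 * fderivWithin ℝ (metricCoord I p) (range I) (extChartAt I p p) (toCoord I p p (X p))
        (toCoord I p p e) (toCoord I p p e)), ← Finset.sum_add_distrib, divergence]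
    refine Finset.sum_congr rfl fun k _ ↦ ?_
    rw [leviCivita, sum_inner, Finset.sum_eq_single k]
    · rw [real_inner_smul_left, koszul_extend hX, real_inner_self_eq_norm_sq,
        OrthonormalBasis.norm_eq_one, fderivWithin_metricCoord_comm p _ (toCoord I p p (X p))]
      simp only [LinearMap.comp_apply, ContinuousLinearMap.coe_coe, X']
      ring
    · intro j _ hj
      rw [real_inner_smul_left, OrthonormalBasis.inner_eq_zero _ hj, mul_zero]
    · simp
  have h2 : LinearMap.trace ℝ (TangentSpace I p)
        ((ofCoord I p p).toLinearMap ∘ₗ X'.toLinearMap ∘ₗ (toCoord I p p).toLinearMap) =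
      ∑ i, X' (EuclideanSpace.single i 1) i := by
    rw [LinearMap.trace_eq_matrix_trace ℝ (coordBasis hp), Matrix.trace]
    refine Finset.sum_congr rfl fun i _ ↦ ?_
    rw [Matrix.diag_apply, LinearMap.toMatrix_apply, coordBasis_repr, coe_coordBasis,
      coordVector_eq hp]
    simp only [LinearMap.comp_apply, ContinuousLinearMap.coe_coe, toCoord_ofCoord hp]
  rw [fderivWithin_coordVol, h1, h2]
  ring

end LeviCivita

/-! ### The pointwise identity -/

section VolumeCoord

variable {d : ℕ}
  {H : Type*} [TopologicalSpace H] {I : ModelWithCorners ℝ (EuclideanSpace ℝ (Fin d)) H}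
  {M : Type*} [TopologicalSpace M] [ChartedSpace H M] [IsManifold I ∞ M]
  [RiemannianBundle (fun x : M ↦ TangentSpace I x)]

variable (d) in
/-- The standard determinant on the model space. -/
def stdDet : EuclideanSpace ℝ (Fin d) [⋀^Fin d]→ₗ[ℝ] ℝ :=
  (EuclideanSpace.basisFun (Fin d) ℝ).toBasis.det

lemma stdDet_apply (m : Fin d → EuclideanSpace ℝ (Fin d)) :
    stdDet d m = Matrix.det (Matrix.of fun i j ↦ m j i) := by
  rw [stdDet, Module.Basis.det_apply]
  rfl

lemma volumeForm_eq_stdDet (o : ManifoldOrientation I M) {y z : M} (hz : z ∈ (chartAt H y).source)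
    (m : Fin d → TangentSpace I z) :
    (o.or z).volumeForm m = coordVol o y z * stdDet d (fun i ↦ toCoord I y z (m i)) := by
  rw [volumeForm_eq_det_mul (o.or z) (coordBasis hz), coe_coordBasis, mul_comm, stdDet_apply,
    Module.Basis.det_apply]
  rfl

end VolumeCoord

section Pointwise

variable {d : ℕ}
  {H₁ : Type*} [TopologicalSpace H₁] {I₁ : ModelWithCorners ℝ (EuclideanSpace ℝ (Fin d)) H₁}
  {M₁ : Type*} [TopologicalSpace M₁] [ChartedSpace H₁ M₁] [IsManifold I₁ ∞ M₁]
  [RiemannianBundle (fun x : M₁ ↦ TangentSpace I₁ x)]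
  {H₂ : Type*} [TopologicalSpace H₂] {I₂ : ModelWithCorners ℝ (EuclideanSpace ℝ (Fin d)) H₂}
  {M₂ : Type*} [TopologicalSpace M₂] [ChartedSpace H₂ M₂] [IsManifold I₂ ∞ M₂]
  [RiemannianBundle (fun x : M₂ ↦ TangentSpace I₂ x)]
  (o₁ : ManifoldOrientation I₁ M₁) (o₂ : ManifoldOrientation I₂ M₂)
  {f : M₁ → M₂}

/-- The vector field `(Cof df)^T σ` of a section `σ` of `f^* TM₂`. -/
def piolaAlong (f : M₁ → M₂) (σ : ∀ p : M₁, TangentSpace I₂ (f p)) (p : M₁) : TangentSpace I₁ p :=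
  LinearMap.adjoint (cofDifferential o₁ o₂ f p) (σ p)

/-- `(Cof df)^T` in coordinates. -/
lemma coordVol_mul_toCoord_adjoint [NeZero d] {p q : M₁} {y : M₂} (hq : q ∈ (chartAt H₁ p).source)
    (hy : f q ∈ (chartAt H₂ y).source) (w : TangentSpace I₂ (f q)) (i : Fin d) :
    coordVol o₁ p q * toCoord I₁ p q (LinearMap.adjoint (cofDifferential o₁ o₂ f q) w) i =
      coordVol o₂ y (f q) * stdDet d (Function.update
        (fun j ↦ toCoord I₂ y (f q) (mfderiv I₁ I₂ f q (coordVector I₁ p q j))) i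
        (toCoord I₂ y (f q) w)) := by
  have h := volumeForm_smul_adjoint_Cof (o₁.or q) (o₂.or (f q)) (mfderiv I₁ I₂ f q).toLinearMap
    (coordBasis hq) w
  have h2 := congrArg (fun v : TangentSpace I₁ q ↦ (coordBasis hq).repr v i) h
  simp only [map_smul, Finsupp.smul_apply, smul_eq_mul, coordBasis_repr, map_sum,
    Finsupp.finsetSum_apply, Module.Basis.repr_self, Finsupp.single_apply, mul_ite, mul_one,
    mul_zero, Finset.sum_ite_eq', Finset.mem_univ, if_true] at h2
  have h3 : coordVol o₁ p q = (o₁.or q).volumeForm (coordBasis hq) := by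
    rw [coe_coordBasis]; rfl
  rw [h3]
  refine h2.trans ?_
  rw [volumeForm_eq_stdDet o₂ hy]
  congr 2
  ext1 j
  by_cases hj : j = i
  · subst hj; simp
  · simp [Function.update_of_ne hj, coe_coordBasis]

lemma contMDiffAt_mfderiv_coordVector (hf : ContMDiff I₁ I₂ ∞ f) {p q : M₁}
    (hq : q ∈ (chartAt H₁ p).source) (j : Fin d) :
    ContMDiffAt I₁ I₂.tangent ∞ (fun x ↦ (⟨f x, mfderiv I₁ I₂ f x (coordVector I₁ p x j)⟩ :
      TangentBundle I₂ M₂)) q := by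
  have h1 : ContMDiff I₁.tangent I₂.tangent ∞ (tangentMap I₁ I₂ f) :=
    hf.contMDiff_tangentMap (by simp)
  exact h1.contMDiffAt.comp q (contMDiffAt_coordVector hq j)

variable [IsContMDiffRiemannianBundle I₁ ∞ (EuclideanSpace ℝ (Fin d))
    (fun x : M₁ ↦ TangentSpace I₁ x)]
  [IsContMDiffRiemannianBundle I₂ ∞ (EuclideanSpace ℝ (Fin d)) (fun x : M₂ ↦ TangentSpace I₂ x)]

/-- Cramer's formula in charts writes each component as the density of M₂ along f times a
determinant of smooth entries, divided by the nonvanishing density of M₁. -/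
lemma contMDiff_piolaAlong [NeZero d] (hf : ContMDiff I₁ I₂ ∞ f)
    {σ : ∀ p : M₁, TangentSpace I₂ (f p)} (hσ : IsSmoothAlong I₁ I₂ f σ) :
    ContMDiff I₁ I₁.tangent ∞
      (fun p ↦ (⟨p, piolaAlong o₁ o₂ f σ p⟩ : TangentBundle I₁ M₁)) := by
  intro q
  have hq := mem_chart_source H₁ q
  have hy := mem_chart_source H₂ (f q)
  refine (contMDiffAt_along_iff (b := fun q ↦ q) hq).2 ⟨contMDiffAt_id, ?_⟩
  have hcoord : ∀ {τ : ∀ p : M₁, TangentSpace I₂ (f p)}, ContMDiffAt I₁ I₂.tangent ∞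
      (fun p ↦ (⟨f p, τ p⟩ : TangentBundle I₂ M₂)) q → ∀ k : Fin d, ContMDiffAt I₁ 𝓘(ℝ, ℝ) ∞
      (fun x ↦ toCoord I₂ (f q) (f x) (τ x) k) q := by
    intro τ hτ k
    have h3 := ((contMDiffAt_along_iff hy).1 hτ).2
    have h4 : ContDiff ℝ ∞ (fun v : EuclideanSpace ℝ (Fin d) ↦ v k) := by fun_prop
    exact h4.contMDiff.contMDiffAt.comp q h3
  have hcomp : ∀ i, ContMDiffAt I₁ 𝓘(ℝ, ℝ) ∞
      (fun x ↦ toCoord I₁ q x (piolaAlong o₁ o₂ f σ x) i) q := by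
    intro i
    have he : (fun x ↦ toCoord I₁ q x (piolaAlong o₁ o₂ f σ x) i) =ᶠ[𝓝 q]
        fun x ↦ (coordVol o₁ q x)⁻¹ * (coordVol o₂ (f q) (f x) * Matrix.det (Matrix.of fun k j ↦
          (Function.update (fun j ↦ toCoord I₂ (f q) (f x)
            (mfderiv I₁ I₂ f x (coordVector I₁ q x j))) i (toCoord I₂ (f q) (f x) (σ x))) j k)) := by
      filter_upwards [(chartAt H₁ q).open_source.mem_nhds hq,
        hf.continuous.continuousAt.preimage_mem_nhds ((chartAt H₂ (f q)).open_source.mem_nhds hy)]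
        with x hx hfx
      rw [← stdDet_apply, ← coordVol_mul_toCoord_adjoint o₁ o₂ hx hfx,
        inv_mul_cancel_left₀ (coordVol_ne_zero o₁ hx)]
      rfl
    refine ContMDiffAt.congr_of_eventuallyEq ?_ he
    refine ContMDiffAt.mul ?_ (ContMDiffAt.mul ?_ (contMDiffAt_det fun k j ↦ ?_))
    · have hi : ContDiffAt ℝ ∞ (fun t : ℝ ↦ t⁻¹) (coordVol o₁ q q) :=
        contDiffAt_inv ℝ (coordVol_ne_zero o₁ hq)
      exact hi.contMDiffAt.comp q (contMDiffAt_coordVol o₁ hq)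
    · exact (contMDiffAt_coordVol o₂ hy).comp q hf.contMDiffAt
    · by_cases hj : j = i
      · subst hj
        simpa using hcoord hσ.contMDiffAt k
      · simpa [Function.update_of_ne hj] using
          hcoord (contMDiffAt_mfderiv_coordVector hf hq j) k
  rw [contMDiffAt_iff_source_of_mem_source hq, contMDiffWithinAt_iff_contDiffWithinAt,
    contDiffWithinAt_euclidean]
  intro i
  exact contDiffWithinAt_comp_symm hq (hcomp i)

/-- The pulled back connection in coordinates. -/
lemma pullbackConnection_eq (hf : ContMDiff I₁ I₂ ∞ f)
    (σ : ∀ p : M₁, TangentSpace I₂ (f p)) (q : M₁)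
    (u : TangentSpace I₁ q) :
    pullbackConnection I₁ I₂ f σ q u =
      ofCoord I₂ (f q) (f q) (mvfderiv I₁ (fun x ↦ toCoord I₂ (f q) (f x) (σ x)) q u) +
        leviCivita I₂ (FiberBundle.extend (EuclideanSpace ℝ (Fin d)) (σ q)) (f q)
          (mfderiv I₁ I₂ f q u) := by
  have hy := mem_chart_source H₂ (f q)
  rw [pullbackConnection, ofCoord_apply hy]
  congr 2
  have he : (fun x ↦ toCoord I₂ (f q) (f x) (σ x)) =ᶠ[𝓝 q] fun x ↦
      ((trivializationAt (EuclideanSpace ℝ (Fin d)) (TangentSpace I₂ (M := M₂)) (f q))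
          ⟨f x, σ x⟩).2 := by
    filter_upwards [hf.continuous.continuousAt.preimage_mem_nhds
      ((chartAt H₂ (f q)).open_source.mem_nhds hy)] with x hx
    exact toCoord_apply hx _
  exact (congrArg (fun L ↦ L u) (he.mfderiv_eq (I := I₁)
    (I' := 𝓘(ℝ, EuclideanSpace ℝ (Fin d))))).symm

/-- The integrand `⟨∇σ, Cof df⟩`. -/
def connectionInnerCof (f : M₁ → M₂) (σ : ∀ p : M₁, TangentSpace I₂ (f p)) (p : M₁) : ℝ :=
  ∑ i, inner ℝ
    (pullbackConnection I₁ I₂ f σ p (stdOrthonormalBasis ℝ (TangentSpace I₁ p) i))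
    (cofDifferential o₁ o₂ f p (stdOrthonormalBasis ℝ (TangentSpace I₁ p) i))

/-- Linearity in u turns ⟨∇σ, Cof df⟩ into a trace, which can be computed in the coordinate basis
instead of an orthonormal one. -/
lemma exists_linear_pullbackConnection (hf : ContMDiff I₁ I₂ ∞ f)
    (σ : ∀ p : M₁, TangentSpace I₂ (f p)) (q : M₁) :
    ∃ L : TangentSpace I₁ q →ₗ[ℝ] TangentSpace I₂ (f q),
      ∀ u, pullbackConnection I₁ I₂ f σ q u = L u := by
  obtain ⟨Γ, hΓ⟩ := exists_linear_leviCivita (contMDiffAt_extend (I := I₂) (σ q))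
  refine ⟨(ofCoord I₂ (f q) (f q)).toLinearMap ∘ₗ
    (mvfderiv I₁ (fun x ↦ toCoord I₂ (f q) (f x) (σ x)) q).toLinearMap +
    Γ ∘ₗ (mfderiv I₁ I₂ f q).toLinearMap, fun u ↦ ?_⟩
  rw [pullbackConnection_eq hf, hΓ]
  rfl

/-- `⟨∇σ, Cof df⟩` is a trace. -/
lemma connectionInnerCof_eq_trace {σ : ∀ p : M₁, TangentSpace I₂ (f p)} {q : M₁}
    {L : TangentSpace I₁ q →ₗ[ℝ] TangentSpace I₂ (f q)}
    (hL : ∀ u, pullbackConnection I₁ I₂ f σ q u = L u) :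
    connectionInnerCof o₁ o₂ f σ q = LinearMap.trace ℝ (TangentSpace I₁ q)
      (LinearMap.adjoint (cofDifferential o₁ o₂ f q) ∘ₗ L) := by
  rw [trace_eq_sum_inner, connectionInnerCof]
  refine Finset.sum_congr rfl fun k _ ↦ ?_
  rw [hL, LinearMap.comp_apply, LinearMap.adjoint_inner_left]

/-- In any chart of `M₁`, `⟨∇σ, Cof df⟩` is the coordinate divergence of `(Cof df)^T σ`. -/
lemma coordVol_mul_connectionInnerCof [NeZero d] (hf : ContMDiff I₁ I₂ ∞ f)
    {σ : ∀ p : M₁, TangentSpace I₂ (f p)} (hσ : IsSmoothAlong I₁ I₂ f σ) {p q : M₁}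
    (hq : q ∈ (chartAt H₁ p).source) :
    coordVol o₁ p q * connectionInnerCof o₁ o₂ f σ q =
      ∑ i, fderivWithin ℝ (fun x ↦ coordVol o₁ p ((extChartAt I₁ p).symm x) *
        fieldCoord I₁ p (piolaAlong o₁ o₂ f σ) x i) (range I₁) (extChartAt I₁ p q)
        (EuclideanSpace.single i 1) := by
  have hy := mem_chart_source H₂ (f q)
  set b : Fin d → EuclideanSpace ℝ (Fin d) := fun i ↦ EuclideanSpace.single i 1
  set x₀ := extChartAt I₁ p q with hx₀
  -- The chart of M₂ is centred at f q, where the coordinate formula for the connection is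
  -- available. The chart of M₁ is arbitrary, because continuity and integration over a chart domain
  -- need the formula at all of its points.
  set φ := extChartAt I₂ (f q) ∘ f ∘ (extChartAt I₁ p).symm with hφdef
  set s : EuclideanSpace ℝ (Fin d) → EuclideanSpace ℝ (Fin d) :=
    (fun x ↦ toCoord I₂ (f q) (f x) (σ x)) ∘ (extChartAt I₁ p).symm with hs
  set w := coordVol o₂ (f q) ∘ (extChartAt I₂ (f q)).symm with hw
  have hsymm : (extChartAt I₁ p).symm x₀ = q := extChartAt_symm_apply hq
  have hφx : φ x₀ = extChartAt I₂ (f q) (f q) :=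
    congrArg (fun z ↦ extChartAt I₂ (f q) (f z)) hsymm
  have hmf : ∀ x, MDifferentiableAt I₁ I₂ f x := fun x ↦ hf.contMDiffAt.mdifferentiableAt (by simp)
  have hsσ := ((contMDiffAt_along_iff hy).1 hσ.contMDiffAt).2
  have hDφ : ∀ x ∈ (extChartAt I₁ p).target,
      f ((extChartAt I₁ p).symm x) ∈ (chartAt H₂ (f q)).source → ∀ j,
      toCoord I₂ (f q) (f ((extChartAt I₁ p).symm x)) (mfderiv I₁ I₂ f ((extChartAt I₁ p).symm x)
        (coordVector I₁ p ((extChartAt I₁ p).symm x) j)) = fderivWithin ℝ φ (range I₁) x (b j) := by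
    intro x hx hfx j
    rw [coordVector_eq (symm_mem_source hx), toCoord_mfderiv_ofCoord (symm_mem_source hx) hfx
      (hmf _), (extChartAt I₁ p).right_inv hx]
  have hev : ∀ᶠ x in 𝓝[range I₁] x₀, x ∈ (extChartAt I₁ p).target ∧
      f ((extChartAt I₁ p).symm x) ∈ (chartAt H₂ (f q)).source := by
    refine (eventually_mem_target hq).and ?_
    have hc : ContinuousAt (extChartAt I₁ p).symm x₀ :=
      continuousAt_extChartAt_symm' (by rwa [extChartAt_source])
    have hc2 : ContinuousAt (f ∘ (extChartAt I₁ p).symm) x₀ :=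
      hf.continuous.continuousAt.comp hc
    refine (hc2.eventually ?_).filter_mono nhdsWithin_le_nhds
    rw [Function.comp_apply, hsymm]
    exact (chartAt H₂ (f q)).open_source.mem_nhds hy
  have hfun : ∀ i, (fun x ↦ coordVol o₁ p ((extChartAt I₁ p).symm x) *
        fieldCoord I₁ p (piolaAlong o₁ o₂ f σ) x i) =ᶠ[𝓝[range I₁] x₀]
      fun x ↦ w (φ x) * stdDet d (Function.update
        (fun j ↦ fderivWithin ℝ φ (range I₁) x (b j)) i (s x)) := by
    intro i
    filter_upwards [hev] with x hx
    rw [fieldCoord, piolaAlong, coordVol_mul_toCoord_adjoint o₁ o₂ (symm_mem_source hx.1) hx.2]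
    simp only [hDφ x hx.1 hx.2]
    have : w (φ x) = coordVol o₂ (f q) (f ((extChartAt I₁ p).symm x)) := by
      simp only [hw, hφdef, Function.comp_apply]
      rw [extChartAt_symm_apply hx.2]
    rw [this]
    rfl
  have hφc : ContDiffWithinAt ℝ 2 φ (range I₁) x₀ := by
    have h1 : ContMDiffAt I₁ 𝓘(ℝ, EuclideanSpace ℝ (Fin d)) ∞ (extChartAt I₂ (f q) ∘ f) q :=
      (contMDiffAt_extChartAt' hy).comp q hf.contMDiffAt
    exact (contDiffWithinAt_comp_symm hq h1).of_le ENat.LEInfty.out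
  have hsd : DifferentiableWithinAt ℝ s (range I₁) x₀ :=
    (contDiffWithinAt_comp_symm hq hsσ).differentiableWithinAt (by simp)
  have hmaps : MapsTo φ (range I₁) (range I₂) := fun x _ ↦ extChartAt_mem_range _ _
  have hwd : DifferentiableWithinAt ℝ w (range I₂) (φ x₀) := by
    rw [hφx]
    exact (contDiffWithinAt_comp_symm hy (contMDiffAt_coordVol o₂ hy)).differentiableWithinAt
      (by simp)
  have hm := extChartAt_mem_range (I := I₁) p q
  have hR := sum_fderivWithin_weighted_substitution (EuclideanSpace.basisFun (Fin d) ℝ).toBasis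
    (stdDet d) b I₁.uniqueDiffOn (I₁.range_subset_closure_interior hm) hm hφc hsd hmaps hwd
  have hRHS : ∑ i, fderivWithin ℝ (fun x ↦ coordVol o₁ p ((extChartAt I₁ p).symm x) *
        fieldCoord I₁ p (piolaAlong o₁ o₂ f σ) x i) (range I₁) x₀ (b i) =
      ∑ i, fderivWithin ℝ (fun x ↦ w (φ x) * stdDet d (Function.update
        (fun j ↦ fderivWithin ℝ φ (range I₁) x (b j)) i (s x))) (range I₁) x₀ (b i) :=
    Finset.sum_congr rfl fun i _ ↦ by rw [(hfun i).fderivWithin_eq_of_mem hm]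
  refine Eq.trans ?_ (hRHS.trans hR).symm
  obtain ⟨Γ, hΓ⟩ := exists_linear_leviCivita (contMDiffAt_extend (I := I₂) (σ q))
  obtain ⟨L, hL⟩ := exists_linear_pullbackConnection hf σ q
  have hx₀t : x₀ ∈ (extChartAt I₁ p).target :=
    (extChartAt I₁ p).map_source (by rwa [extChartAt_source])
  have hDφq : ∀ j, toCoord I₂ (f q) (f q) (mfderiv I₁ I₂ f q (coordVector I₁ p q j)) =
      fderivWithin ℝ φ (range I₁) x₀ (b j) := by
    intro j
    have := hDφ x₀ hx₀t (by rw [hsymm]; exact hy) j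
    rwa [hsymm] at this
  have hdf : ∀ j, mfderiv I₁ I₂ f q (coordVector I₁ p q j) =
      ofCoord I₂ (f q) (f q) (fderivWithin ℝ φ (range I₁) x₀ (b j)) := by
    intro j
    rw [← hDφq, ofCoord_toCoord hy]
  have hLi : ∀ i, toCoord I₂ (f q) (f q) (L (coordVector I₁ p q i)) =
      fderivWithin ℝ s (range I₁) x₀ (b i) +
        ((toCoord I₂ (f q) (f q)).toLinearMap ∘ₗ Γ ∘ₗ (ofCoord I₂ (f q) (f q)).toLinearMap)
          (fderivWithin ℝ φ (range I₁) x₀ (b i)) := by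
    intro i
    rw [← hL, pullbackConnection_eq hf, map_add, toCoord_ofCoord hy, hΓ, hdf]
    congr 1
    rw [coordVector_eq hq, mvfderiv_ofCoord hq (hsσ.mdifferentiableAt (by simp))]
  -- Γ is the zeroth-order part of the connection: u ↦ ∇_u of the field through σ q with constant
  -- coordinates. Its trace is the divergence of that field, hence the logarithmic derivative of the
  -- density of M₂ along σ q.
  have htr : LinearMap.trace ℝ (EuclideanSpace ℝ (Fin d))
      ((toCoord I₂ (f q) (f q)).toLinearMap ∘ₗ Γ ∘ₗ (ofCoord I₂ (f q) (f q)).toLinearMap) =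
      divergence I₂ (FiberBundle.extend (EuclideanSpace ℝ (Fin d)) (σ q)) (f q) := by
    rw [LinearMap.trace_comp_comm', LinearMap.comp_assoc]
    have : (ofCoord I₂ (f q) (f q)).toLinearMap ∘ₗ (toCoord I₂ (f q) (f q)).toLinearMap =
        LinearMap.id := LinearMap.ext fun v ↦ ofCoord_toCoord hy v
    rw [this, LinearMap.comp_id, trace_eq_sum_inner, divergence]
    simp only [hΓ]
  have hdiv := divergence_eq o₂ (contMDiffAt_extend (I := I₂) (σ q))
  simp only [fderivWithin_fieldCoord_extend, zero_apply, PiLp.zero_apply, Finset.sum_const_zero,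
    mul_zero, zero_add, FiberBundle.extend_apply_self] at hdiv
  have hs0 : s x₀ = toCoord I₂ (f q) (f q) (σ q) := by
    have : ∀ z, z = q → toCoord I₂ (f q) (f z) (σ z) = toCoord I₂ (f q) (f q) (σ q) := by
      rintro _ rfl; rfl
    exact this _ hsymm
  have hw0 : w (φ x₀) = coordVol o₂ (f q) (f q) := by
    simp only [hφx, hw, Function.comp_apply, extChartAt_symm_apply hy]
  rw [connectionInnerCof_eq_trace o₁ o₂ hL, LinearMap.trace_eq_matrix_trace ℝ (coordBasis hq),
    Matrix.trace, Finset.mul_sum]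
  have hterm : ∀ i, coordVol o₁ p q * Matrix.diag (LinearMap.toMatrix (coordBasis hq)
      (coordBasis hq) (LinearMap.adjoint (cofDifferential o₁ o₂ f q) ∘ₗ L)) i =
      w (φ x₀) * stdDet d (Function.update (fun j ↦ fderivWithin ℝ φ (range I₁) x₀ (b j)) i
          (fderivWithin ℝ s (range I₁) x₀ (b i))) +
      w (φ x₀) * stdDet d (Function.update (fun j ↦ fderivWithin ℝ φ (range I₁) x₀ (b j)) i
        (((toCoord I₂ (f q) (f q)).toLinearMap ∘ₗ Γ ∘ₗ (ofCoord I₂ (f q) (f q)).toLinearMap)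
          (fderivWithin ℝ φ (range I₁) x₀ (b i)))) := by
    intro i
    rw [Matrix.diag_apply, LinearMap.toMatrix_apply, coordBasis_repr, coe_coordBasis,
      LinearMap.comp_apply, coordVol_mul_toCoord_adjoint o₁ o₂ hq hy, hLi,
      AlternatingMap.map_update_add, hw0, mul_add]
    simp only [hDφq]
  rw [Finset.sum_congr rfl fun i _ ↦ hterm i, Finset.sum_add_distrib, ← Finset.mul_sum,
    ← Finset.mul_sum]
  congr 1
  -- Letting Γ act on one column of Dφ at a time multiplies the determinant by tr Γ, which is the
  -- contribution of the weight on the other side.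
  rw [sum_substitution_trace (stdDet d) (EuclideanSpace.basisFun (Fin d) ℝ).toBasis
    ((toCoord I₂ (f q) (f q)).toLinearMap ∘ₗ Γ ∘ₗ (ofCoord I₂ (f q) (f q)).toLinearMap)
    (fun j ↦ fderivWithin ℝ φ (range I₁) x₀ (b j)), htr, hw0, hs0, hφx, ← hdiv]
  ring

end Pointwise

/-! ### The divergence of the Piola transform -/

section PiolaIdentity

variable {d : ℕ}
  {H₁ : Type*} [TopologicalSpace H₁] {I₁ : ModelWithCorners ℝ (EuclideanSpace ℝ (Fin d)) H₁}
  {M₁ : Type*} [TopologicalSpace M₁] [ChartedSpace H₁ M₁] [IsManifold I₁ ∞ M₁]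
  [RiemannianBundle (fun x : M₁ ↦ TangentSpace I₁ x)]
  [IsContMDiffRiemannianBundle I₁ ∞ (EuclideanSpace ℝ (Fin d)) (fun x : M₁ ↦ TangentSpace I₁ x)]
  {H₂ : Type*} [TopologicalSpace H₂] {I₂ : ModelWithCorners ℝ (EuclideanSpace ℝ (Fin d)) H₂}
  {M₂ : Type*} [TopologicalSpace M₂] [ChartedSpace H₂ M₂] [IsManifold I₂ ∞ M₂]
  [RiemannianBundle (fun x : M₂ ↦ TangentSpace I₂ x)]
  [IsContMDiffRiemannianBundle I₂ ∞ (EuclideanSpace ℝ (Fin d)) (fun x : M₂ ↦ TangentSpace I₂ x)]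

/-- The divergence as a coordinate divergence. -/
lemma coordVol_mul_divergence [NeZero d] (o : ManifoldOrientation I₁ M₁)
    {X : ∀ q : M₁, TangentSpace I₁ q} {p : M₁}
    (hX : ContMDiffAt I₁ I₁.tangent ∞ (fun q ↦ (⟨q, X q⟩ : TangentBundle I₁ M₁)) p) :
    coordVol o p p * divergence I₁ X p =
      ∑ i, fderivWithin ℝ (fun x ↦ coordVol o p ((extChartAt I₁ p).symm x) *
        fieldCoord I₁ p X x i) (range I₁) (extChartAt I₁ p p) (EuclideanSpace.single i 1) := by
  have hp := mem_chart_source H₁ p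
  have hu := uniqueDiffWithinAt_extChartAt (I := I₁) p p
  have hW := ((contDiffWithinAt_comp_symm hp
    (contMDiffAt_coordVol o hp)).differentiableWithinAt (by simp)).hasFDerivWithinAt
  have hXd := ((contDiffWithinAt_fieldCoord hp hX).differentiableWithinAt
    (by simp)).hasFDerivWithinAt
  have hterm : ∀ i : Fin d, fderivWithin ℝ (fun x ↦ coordVol o p ((extChartAt I₁ p).symm x) *
        fieldCoord I₁ p X x i) (range I₁) (extChartAt I₁ p p) (EuclideanSpace.single i 1) =
      coordVol o p p * fderivWithin ℝ (fieldCoord I₁ p X) (range I₁) (extChartAt I₁ p p)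
        (EuclideanSpace.single i 1) i +
      toCoord I₁ p p (X p) i * fderivWithin ℝ (coordVol o p ∘ (extChartAt I₁ p).symm) (range I₁)
        (extChartAt I₁ p p) (EuclideanSpace.single i 1) := by
    intro i
    have hXi := (hasFDerivWithinAt_euclidean.1 hXd) i
    refine (congrArg (fun L : EuclideanSpace ℝ (Fin d) →L[ℝ] ℝ ↦ L (EuclideanSpace.single i 1))
      ((hW.mul hXi).fderivWithin hu)).trans ?_
    simp only [Function.comp_apply, extChartAt_to_inv, fieldCoord_extChartAt hp, add_apply,
      smul_apply, smul_eq_mul, ContinuousLinearMap.comp_apply, PiLp.proj_apply]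
  rw [divergence_eq o hX, Finset.sum_congr rfl fun i _ ↦ hterm i, Finset.sum_add_distrib,
    Finset.mul_sum]
  congr 1
  conv_lhs => rw [← (EuclideanSpace.basisFun (Fin d) ℝ).sum_repr (toCoord I₁ p p (X p))]
  simp only [map_sum, map_smul, smul_eq_mul, EuclideanSpace.basisFun_repr,
    EuclideanSpace.basisFun_apply]

/-- The pulled back connection of the pull-back of a vector field. -/
lemma pullbackConnection_comp {f : M₁ → M₂} (hf : ContMDiff I₁ I₂ ∞ f)
    {X : ∀ y : M₂, TangentSpace I₂ y}
    (hX : ContMDiff I₂ I₂.tangent ∞ (fun y ↦ (⟨y, X y⟩ : TangentBundle I₂ M₂))) (q : M₁)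
    (u : TangentSpace I₁ q) :
    pullbackConnection I₁ I₂ f (fun p ↦ X (f p)) q u =
      leviCivita I₂ X (f q) (mfderiv I₁ I₂ f q u) := by
  have hy := mem_chart_source H₂ (f q)
  have hs : MDifferentiableAt I₂ 𝓘(ℝ, EuclideanSpace ℝ (Fin d))
      (fun y ↦ toCoord I₂ (f q) y (X y)) (f q) :=
    (((contMDiffAt_along_iff (b := fun y ↦ y) hy).1 hX.contMDiffAt).2).mdifferentiableAt (by simp)
  rw [pullbackConnection_eq hf, leviCivita_eq hX.contMDiffAt]
  -- Both sides have the same zeroth-order term at f q, so only the chain rule for the coordinates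
  -- of X ∘ f is left.
  congr 2
  have h1 := mvfderiv_ofCoord hy hs (toCoord I₂ (f q) (f q) (mfderiv I₁ I₂ f q u))
  rw [ofCoord_toCoord hy] at h1
  refine Eq.trans ?_ h1
  exact congrArg (fun L ↦ L u) (mfderiv_comp (I'' := 𝓘(ℝ, EuclideanSpace ℝ (Fin d))) q hs
    (hf.contMDiffAt.mdifferentiableAt (by simp)))

variable (o₁ : ManifoldOrientation I₁ M₁) (o₂ : ManifoldOrientation I₂ M₂)

/-- By cyclicity of the trace, tr((Cof df)^T ∘ ∇X ∘ df) = tr(∇X ∘ df ∘ (Cof df)^T), and df ∘ (Cof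
df)^T is Det df times the identity. -/
lemma connectionInnerCof_comp [NeZero d] {f : M₁ → M₂} (hf : ContMDiff I₁ I₂ ∞ f)
    {X : ∀ y : M₂, TangentSpace I₂ y}
    (hX : ContMDiff I₂ I₂.tangent ∞ (fun y ↦ (⟨y, X y⟩ : TangentBundle I₂ M₂))) (q : M₁) :
    connectionInnerCof o₁ o₂ f (fun p ↦ X (f p)) q =
      divergence I₂ X (f q) * detDifferential o₁ o₂ f q := by
  obtain ⟨L, hL⟩ := exists_linear_leviCivita (hX.contMDiffAt (x := f q))
  rw [connectionInnerCof_eq_trace o₁ o₂ (L := L ∘ₗ (mfderiv I₁ I₂ f q).toLinearMap) fun u ↦ by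
    rw [pullbackConnection_comp hf hX, hL]; rfl, LinearMap.trace_comp_comm', LinearMap.comp_assoc]
  have h : (mfderiv I₁ I₂ f q).toLinearMap ∘ₗ LinearMap.adjoint (cofDifferential o₁ o₂ f q) =
      detDifferential o₁ o₂ f q • LinearMap.id :=
    LinearMap.ext fun w ↦ comp_adjoint_Cof _ _ _ w
  rw [h, LinearMap.comp_smul, LinearMap.comp_id, map_smul, smul_eq_mul, mul_comm,
    trace_eq_sum_inner, divergence]
  simp only [hL]

lemma isSmoothAlong_comp {f : M₁ → M₂} (hf : ContMDiff I₁ I₂ ∞ f)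
    {X : ∀ y : M₂, TangentSpace I₂ y}
    (hX : ContMDiff I₂ I₂.tangent ∞ (fun y ↦ (⟨y, X y⟩ : TangentBundle I₂ M₂))) :
    IsSmoothAlong I₁ I₂ f (fun p ↦ X (f p)) :=
  hX.comp hf

/-- The divergence of the Piola transform. -/
theorem divergence_piola [NeZero d] {f : M₁ → M₂} (hf : ContMDiff I₁ I₂ ∞ f)
    {X : ∀ y : M₂, TangentSpace I₂ y}
    (hX : ContMDiff I₂ I₂.tangent ∞ (fun y ↦ (⟨y, X y⟩ : TangentBundle I₂ M₂))) (p : M₁) :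
    divergence I₁ (piola o₁ o₂ f X) p = divergence I₂ X (f p) * detDifferential o₁ o₂ f p := by
  have hp := mem_chart_source H₁ p
  have hσ := isSmoothAlong_comp hf hX
  refine mul_left_cancel₀ (coordVol_ne_zero o₁ hp) ?_
  rw [← connectionInnerCof_comp o₁ o₂ hf hX, coordVol_mul_connectionInnerCof o₁ o₂ hf hσ hp]
  exact coordVol_mul_divergence o₁ (contMDiff_piolaAlong o₁ o₂ hf hσ).contMDiffAt

end PiolaIdentity

/-! ### The Riemannian volume -/

/-- The supremum of a family of measures which agree on overlaps restricts to each of them. -/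
lemma iSup_apply_eq_of_overlap {X ι : Type*} [MeasurableSpace X] {μ : ι → Measure X}
    {U : ι → Set X} (hU : ∀ i, MeasurableSet (U i)) (hμ : ∀ i, μ i (U i)ᶜ = 0)
    (hoverlap : ∀ i j A, MeasurableSet A → A ⊆ U i → A ⊆ U j → μ i A = μ j A)
    {t : Set ι} (ht : t.Countable) (hcover : ⋃ i ∈ t, U i = univ) {i : ι} {A : Set X}
    (hA : MeasurableSet A) (hAi : A ⊆ U i) : (⨆ j, μ j) A = μ i A := by
  refine le_antisymm ?_ (le_iSup μ i A)
  rcases t.eq_empty_or_nonempty with rfl | hne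
  · have : A = ∅ := by
      rw [eq_empty_iff_forall_notMem]
      intro x _
      simpa using hcover.symm.subset (mem_univ x)
    simp [this]
  obtain ⟨e, rfl⟩ := ht.exists_eq_range hne
  have hcov : ⋃ n, disjointed (fun n ↦ U (e n)) n = univ := by
    rw [iUnion_disjointed, ← hcover, biUnion_range]
  have hD : ∀ n, MeasurableSet (disjointed (fun n ↦ U (e n)) n) :=
    MeasurableSet.disjointed fun n ↦ hU (e n)
  set D := disjointed (fun n ↦ U (e n)) with hDdef
  have hdisj : Pairwise (Function.onFun Disjoint D) := disjoint_disjointed _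
  have hsub : ∀ n, D n ⊆ U (e n) := fun n ↦ disjointed_subset _ n
  have hsum : ∀ j B, MeasurableSet B → μ j B = ∑' n, μ (e n) (B ∩ D n ∩ U j) := by
    intro j B hB
    have h1 : μ j B = μ j (B ∩ U j) := by
      refine le_antisymm ?_ (measure_mono inter_subset_left)
      calc μ j B ≤ μ j (B ∩ U j) + μ j (B \ U j) := measure_le_inter_add_sdiff _ _ _
        _ ≤ μ j (B ∩ U j) + μ j (U j)ᶜ := by gcongr; exact fun x hx ↦ hx.2
        _ = μ j (B ∩ U j) := by rw [hμ, add_zero]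
    have h2 : B ∩ U j = ⋃ n, B ∩ D n ∩ U j := by
      rw [← iUnion_inter, ← inter_iUnion, hcov, inter_univ]
    rw [h1, h2, measure_iUnion (fun m n hmn ↦ (hdisj hmn).mono
      (fun x hx ↦ hx.1.2) fun x hx ↦ hx.1.2) fun n ↦ (hB.inter (hD n)).inter (hU j)]
    exact tsum_congr fun n ↦ hoverlap j (e n) _ ((hB.inter (hD n)).inter (hU j))
      inter_subset_right fun x hx ↦ hsub n hx.1.2
  -- The measure glued from the disjoint pieces D n dominates every μ j, hence the supremum, and on
  -- subsets of U i it does not exceed μ i.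
  have hle : (⨆ j, μ j) ≤ Measure.sum fun n ↦ (μ (e n)).restrict (D n) := by
    refine iSup_le fun j ↦ Measure.le_iff.2 fun B hB ↦ ?_
    rw [Measure.sum_apply _ hB, hsum j B hB]
    refine ENNReal.tsum_le_tsum fun n ↦ ?_
    rw [Measure.restrict_apply hB]
    exact measure_mono inter_subset_left
  refine (hle A).trans ?_
  rw [Measure.sum_apply _ hA, hsum i A hA]
  refine ENNReal.tsum_le_tsum fun n ↦ ?_
  rw [Measure.restrict_apply hA]
  exact measure_mono fun x hx ↦ ⟨hx, hAi hx.1⟩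

section Volume

variable {d : ℕ}
  {H : Type*} [TopologicalSpace H] {I : ModelWithCorners ℝ (EuclideanSpace ℝ (Fin d)) H}
  {M : Type*} [TopologicalSpace M] [ChartedSpace H M]

lemma measurableSet_extChartAt_target (p : M) : MeasurableSet (extChartAt I p).target := by
  rw [extChartAt_target]
  exact ((chartAt H p).open_target.preimage I.continuous_symm).measurableSet.inter
    I.isClosed_range.measurableSet

lemma measurableSet_target_inter_preimage [MeasurableSpace M] [BorelSpace M] (p : M) {A : Set M}
    (hA : MeasurableSet A) :
    MeasurableSet ((extChartAt I p).target ∩ (extChartAt I p).symm ⁻¹' A) := by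
  have h := (continuousOn_iff_continuous_domRestrict.1 (continuousOn_extChartAt_symm
    (I := I) p)).measurable hA
  have := (measurableSet_extChartAt_target (I := I) p).subtype_image h
  convert this using 1
  ext x
  simp [and_comm]

variable [IsManifold I ∞ M] [RiemannianBundle (fun x : M ↦ TangentSpace I x)]

/-- The transformation law behind the chart independence of √(det g) dx. Only the square of a volume
form enters, so the orientation is an arbitrary choice. -/
lemma gramDet_eq_det_sq_mul {p q z : M} (hp : z ∈ (chartAt H p).source)
    (hq : z ∈ (chartAt H q).source) :
    gramDet I p z = (toCoord I q z ∘L ofCoord I p z).det ^ 2 * gramDet I q z := by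
  let o : Orientation ℝ (TangentSpace I z) (Fin d) := (coordBasis hp).orientation
  have h1 : o.volumeForm (coordVector I p z) ^ 2 = gramDet I p z := volumeForm_sq _ _
  have h2 : o.volumeForm (coordVector I q z) ^ 2 = gramDet I q z := volumeForm_sq _ _
  have h3 := volumeForm_eq_det_mul o (coordBasis hq) (coordVector I p z)
  rw [coe_coordBasis] at h3
  have h4 : (coordBasis hq).det (coordVector I p z) = (toCoord I q z ∘L ofCoord I p z).det := by
    rw [ContinuousLinearMap.det, ← LinearMap.det_toMatrix
      (EuclideanSpace.basisFun (Fin d) ℝ).toBasis, Module.Basis.det_apply]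
    congr 1
    ext i j
    rw [Module.Basis.toMatrix_apply, coordBasis_repr, coordVector_eq hp]
    simp [LinearMap.toMatrix_apply]
  rw [← h1, ← h2, h3, h4, mul_pow]

variable
  [IsContMDiffRiemannianBundle I ∞ (EuclideanSpace ℝ (Fin d)) (fun x : M ↦ TangentSpace I x)]

lemma continuousOn_sqrt_gramDet (p : M) :
    ContinuousOn (fun y ↦ √(gramDet I p ((extChartAt I p).symm y))) (extChartAt I p).target := by
  refine Real.continuous_sqrt.comp_continuousOn ?_
  intro y hy
  exact (contMDiffAt_gramDet (symm_mem_source hy)).continuousAt.comp_continuousWithinAt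
    (continuousOn_extChartAt_symm p y hy)

variable [MeasurableSpace M] [BorelSpace M]

lemma chartVolume_apply (p : M) {A : Set M} (hA : MeasurableSet A) :
    chartVolume I p A = ∫⁻ y in (extChartAt I p).target ∩ (extChartAt I p).symm ⁻¹' A,
      ENNReal.ofReal (√(gramDet I p ((extChartAt I p).symm y))) := by
  have hT := measurableSet_extChartAt_target (I := I) p
  have hm : AEMeasurable (extChartAt I p).symm
      (((volume : Measure (EuclideanSpace ℝ (Fin d))).withDensity fun y ↦
        ENNReal.ofReal (√(gramDet I p ((extChartAt I p).symm y)))).restrict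
        (extChartAt I p).target) :=
    (continuousOn_extChartAt_symm p).aemeasurable hT
  refine (Measure.map_apply_of_aemeasurable hm hA).trans ?_
  rw [Measure.restrict_apply' hT, inter_comm,
    withDensity_apply _ (measurableSet_target_inter_preimage p hA)]

lemma chartVolume_compl_source (p : M) : chartVolume I p (chartAt H p).sourceᶜ = 0 := by
  rw [chartVolume_apply p (chartAt H p).open_source.measurableSet.compl]
  have : (extChartAt I p).target ∩ (extChartAt I p).symm ⁻¹' (chartAt H p).sourceᶜ = ∅ := by
    rw [eq_empty_iff_forall_notMem]
    rintro y ⟨hy, hy2⟩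
    exact hy2 (symm_mem_source hy)
  rw [this, Measure.restrict_empty, lintegral_zero_measure]

/-- The volumes of two charts agree on the overlap of their domains. -/
lemma chartVolume_eq_of_overlap (p q : M) {A : Set M} (hA : MeasurableSet A)
    (hp : A ⊆ (chartAt H p).source) (hq : A ⊆ (chartAt H q).source) :
    chartVolume I p A = chartVolume I q A := by
  rw [chartVolume_apply p hA, chartVolume_apply q hA]
  set S := (extChartAt I p).target ∩ (extChartAt I p).symm ⁻¹' A
  set φ := extChartAt I q ∘ id ∘ (extChartAt I p).symm with hφ
  have hS : MeasurableSet S := measurableSet_target_inter_preimage p hA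
  have himg : φ '' S = (extChartAt I q).target ∩ (extChartAt I q).symm ⁻¹' A := by
    ext y
    constructor
    · rintro ⟨x, hx, rfl⟩
      have hxq := hq hx.2
      refine ⟨(extChartAt I q).map_source (by rwa [extChartAt_source]), ?_⟩
      rw [mem_preimage, hφ, Function.comp_apply, Function.comp_apply, id,
        extChartAt_symm_apply hxq]
      exact hx.2
    · rintro ⟨hy, hyA⟩
      have hyp := hp hyA
      refine ⟨extChartAt I p ((extChartAt I q).symm y),
        ⟨(extChartAt I p).map_source (by rwa [extChartAt_source]), ?_⟩, ?_⟩
      · rw [mem_preimage, extChartAt_symm_apply hyp]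
        exact hyA
      · rw [hφ, Function.comp_apply, Function.comp_apply, id, extChartAt_symm_apply hyp,
          (extChartAt I q).right_inv hy]
  have hinj : InjOn φ S := by
    intro x hx y hy hxy
    have h1 : (extChartAt I p).symm x = (extChartAt I p).symm y :=
      (extChartAt I q).injOn (by rw [extChartAt_source]; exact hq hx.2)
        (by rw [extChartAt_source]; exact hq hy.2) hxy
    exact (extChartAt I p).symm.injOn hx.1 hy.1 h1
  have hderiv : ∀ x ∈ S, HasFDerivWithinAt φ (toCoord I q ((extChartAt I p).symm x) ∘L
      ofCoord I p ((extChartAt I p).symm x)) S x := by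
    intro x hx
    have hzp := hp hx.2
    have hzq := hq hx.2
    have hd : DifferentiableWithinAt ℝ φ (range I) x := by
      have h1 : ContMDiffAt I 𝓘(ℝ, EuclideanSpace ℝ (Fin d)) ∞ (extChartAt I q ∘ id)
          ((extChartAt I p).symm x) := contMDiffAt_extChartAt' hzq
      have h2 := (contDiffWithinAt_comp_symm hzp h1).differentiableWithinAt (by simp)
      rwa [(extChartAt I p).right_inv hx.1] at h2
    have he : fderivWithin ℝ φ (range I) x = toCoord I q ((extChartAt I p).symm x) ∘L
        ofCoord I p ((extChartAt I p).symm x) := by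
      ext1 v
      have h := toCoord_mfderiv_ofCoord (I₁ := I) (I₂ := I) (f := id) hzp hzq
        mdifferentiableAt_id v
      rw [(extChartAt I p).right_inv hx.1, mfderiv_id] at h
      exact h.symm
    rw [← he]
    exact hd.hasFDerivWithinAt.mono
      (inter_subset_left.trans (extChartAt_target_subset_range p))
  -- This change of variables allows an injective map differentiable within a measurable set, so
  -- charts with boundary need no separate treatment.
  rw [← himg, lintegral_image_eq_lintegral_abs_det_fderiv_mul volume hS hderiv hinj]
  refine setLIntegral_congr_fun hS fun x hx ↦ ?_
  have hzq := hq hx.2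
  have hsymm : (extChartAt I q).symm (φ x) = (extChartAt I p).symm x := by
    rw [hφ, Function.comp_apply, Function.comp_apply, id, extChartAt_symm_apply hzq]
  simp only [hsymm]
  rw [← ENNReal.ofReal_mul (abs_nonneg _), gramDet_eq_det_sq_mul (hp hx.2) hzq,
    Real.sqrt_mul (sq_nonneg _), Real.sqrt_sq_eq_abs]

variable [SecondCountableTopology M]

lemma riemannianVolume_apply {p : M} {A : Set M} (hA : MeasurableSet A)
    (hp : A ⊆ (chartAt H p).source) : riemannianVolume I M A = chartVolume I p A := by
  obtain ⟨t, ht, hcover⟩ := TopologicalSpace.countable_cover_nhds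
    fun x : M ↦ (chartAt H x).open_source.mem_nhds (mem_chart_source H x)
  exact iSup_apply_eq_of_overlap (fun i ↦ (chartAt H i).open_source.measurableSet)
    chartVolume_compl_source (fun i j B hB hi hj ↦ chartVolume_eq_of_overlap i j hB hi hj) ht hcover
    hA hp

lemma riemannianVolume_restrict (p : M) :
    (riemannianVolume I M).restrict (chartAt H p).source = chartVolume I p := by
  have hU : MeasurableSet (chartAt H p).source := (chartAt H p).open_source.measurableSet
  ext A hA
  rw [Measure.restrict_apply hA, riemannianVolume_apply (hA.inter hU) inter_subset_right]
  refine le_antisymm (measure_mono inter_subset_left) ?_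
  calc chartVolume I p A ≤ chartVolume I p (A ∩ (chartAt H p).source) +
        chartVolume I p (A \ (chartAt H p).source) := measure_le_inter_add_sdiff _ _ _
    _ ≤ chartVolume I p (A ∩ (chartAt H p).source) + chartVolume I p (chartAt H p).sourceᶜ := by
        gcongr; exact fun x hx ↦ hx.2
    _ = chartVolume I p (A ∩ (chartAt H p).source) := by
        rw [chartVolume_compl_source, add_zero]

/-- Integration in a chart. -/
lemma integral_riemannianVolume_of_chart (p : M) {F : M → ℝ} (hF : Continuous F)
    (hs : ∀ q ∉ (chartAt H p).source, F q = 0) :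
    ∫ q, F q ∂(riemannianVolume I M) =
      ∫ y in (extChartAt I p).target,
        √(gramDet I p ((extChartAt I p).symm y)) * F ((extChartAt I p).symm y) := by
  have hT := measurableSet_extChartAt_target (I := I) p
  rw [← setIntegral_eq_integral_of_forall_compl_eq_zero hs, riemannianVolume_restrict]
  have hm : AEMeasurable (extChartAt I p).symm
      (((volume : Measure (EuclideanSpace ℝ (Fin d))).withDensity fun y ↦
        ENNReal.ofReal (√(gramDet I p ((extChartAt I p).symm y)))).restrict
        (extChartAt I p).target) :=
    (continuousOn_extChartAt_symm p).aemeasurable hT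
  refine (integral_map hm hF.measurable.aestronglyMeasurable).trans ?_
  rw [setIntegral_withDensity_eq_setIntegral_toReal_smul₀
    ((continuousOn_sqrt_gramDet p).aemeasurable hT).ennreal_ofReal
    (ae_of_all _ fun _ ↦ ENNReal.ofReal_lt_top) _ hT]
  simp only [ENNReal.toReal_ofReal (Real.sqrt_nonneg _), smul_eq_mul]

/-- Used for the integrability of compactly supported continuous functions. Since `range I` is
closed, a small closed ball meets it in a compact subset of the chart target, on which √(det g) is
bounded. -/
lemma isLocallyFiniteMeasure_riemannianVolume :
    IsLocallyFiniteMeasure (riemannianVolume I M) := by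
  refine ⟨fun p ↦ ?_⟩
  have hp := mem_chart_source H p
  obtain ⟨r, hr, hball⟩ := Metric.mem_nhdsWithin_iff.1 (extChartAt_target_mem_nhdsWithin (I := I) p)
  set K := Metric.closedBall (extChartAt I p p) (r / 2) ∩ range I
  have hK : IsCompact K := (isCompact_closedBall _ _).inter_right I.isClosed_range
  have hKT : K ⊆ (extChartAt I p).target := fun x hx ↦
    hball ⟨Metric.closedBall_subset_ball (by linarith) hx.1, hx.2⟩
  set A := (chartAt H p).source ∩ extChartAt I p ⁻¹' Metric.ball (extChartAt I p p) (r / 2)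
  have hA : IsOpen A := by
    have := (continuousOn_extChartAt (I := I) p)
    rw [extChartAt_source] at this
    exact this.isOpen_inter_preimage (chartAt H p).open_source Metric.isOpen_ball
  have hpA : p ∈ A := ⟨hp, Metric.mem_ball_self (by linarith)⟩
  refine ⟨A, hA.mem_nhds hpA, ?_⟩
  rw [riemannianVolume_apply hA.measurableSet inter_subset_left,
    chartVolume_apply p hA.measurableSet]
  have hsub : (extChartAt I p).target ∩ (extChartAt I p).symm ⁻¹' A ⊆ K := by
    rintro x ⟨hx, hxA⟩
    have h2 := hxA.2
    rw [mem_preimage, (extChartAt I p).right_inv hx] at h2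
    exact ⟨Metric.ball_subset_closedBall h2, extChartAt_target_subset_range p hx⟩
  obtain ⟨C, hC⟩ := (hK.image_of_continuousOn ((continuousOn_sqrt_gramDet p).mono hKT)).bddAbove
  calc _ ≤ ∫⁻ y in K, ENNReal.ofReal (√(gramDet I p ((extChartAt I p).symm y))) :=
        lintegral_mono_set hsub
    _ ≤ ∫⁻ _ in K, ENNReal.ofReal C := setLIntegral_mono' hK.measurableSet fun x hx ↦
        ENNReal.ofReal_le_ofReal (hC (mem_image_of_mem _ hx))
    _ < ⊤ := by
        rw [setLIntegral_const]
        exact ENNReal.mul_lt_top ENNReal.ofReal_lt_top hK.measure_lt_top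

/-- Used for uniqueness. Even at a boundary point, a relative neighbourhood in `range I` contains a
nonempty open set of the model space, because `range I` lies in the closure of its interior; the
density is positive there. -/
lemma isOpenPosMeasure_riemannianVolume :
    (riemannianVolume I M).IsOpenPosMeasure := by
  refine ⟨fun U hU ⟨p, hpU⟩ hzero ↦ ?_⟩
  have hp := mem_chart_source H p
  set A := U ∩ (chartAt H p).source
  have hA : IsOpen A := hU.inter (chartAt H p).open_source
  have h0 : riemannianVolume I M A = 0 := measure_mono_null inter_subset_left hzero
  rw [riemannianVolume_apply hA.measurableSet inter_subset_right,
    chartVolume_apply p hA.measurableSet, lintegral_eq_zero_iff'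
    (((continuousOn_sqrt_gramDet p).mono inter_subset_left).aemeasurable
      (measurableSet_target_inter_preimage p hA.measurableSet)).ennreal_ofReal] at h0
  set S := (extChartAt I p).target ∩ (extChartAt I p).symm ⁻¹' A
  have hS : MeasurableSet S := measurableSet_target_inter_preimage p hA.measurableSet
  have hS0 : volume S = 0 := by
    rw [Filter.EventuallyEq, ae_restrict_iff' hS] at h0
    refine measure_mono_null ?_ (ae_iff.1 h0)
    intro x hx h
    have hpos := Real.sqrt_pos.2 (gramDet_pos (I := I) (symm_mem_source hx.1))
    have := h hx
    simp only [Pi.zero_apply, ENNReal.ofReal_eq_zero] at this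
    exact absurd this (not_le.2 hpos)
  have hnhds : S ∈ 𝓝[range I] (extChartAt I p p) := by
    refine inter_mem (extChartAt_target_mem_nhdsWithin p) (mem_nhdsWithin_of_mem_nhds ?_)
    refine (continuousAt_extChartAt_symm (I := I) p).preimage_mem_nhds (hA.mem_nhds ?_)
    rw [extChartAt_to_inv]
    exact ⟨hpU, hp⟩
  obtain ⟨V, hV, hxV, hVS⟩ := mem_nhdsWithin.1 hnhds
  have hcl := I.range_subset_closure_interior (extChartAt_mem_range (I := I) p p)
  have hne : (V ∩ interior (range I)).Nonempty := mem_closure_iff.1 hcl V hV hxV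
  have hpos := (hV.inter isOpen_interior).measure_pos volume hne
  exact hpos.ne' (measure_mono_null (fun x hx ↦ hVS ⟨hx.1, interior_subset hx.2⟩) hS0)

end Volume

/-! ### The cofactor of the differential is coclosed -/

section Coclosed

variable {d : ℕ}
  {H₁ : Type*} [TopologicalSpace H₁] {I₁ : ModelWithCorners ℝ (EuclideanSpace ℝ (Fin d)) H₁}
  {M₁ : Type*} [TopologicalSpace M₁] [ChartedSpace H₁ M₁]
  {H₂ : Type*} [TopologicalSpace H₂] {I₂ : ModelWithCorners ℝ (EuclideanSpace ℝ (Fin d)) H₂}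
  {M₂ : Type*} [TopologicalSpace M₂] [ChartedSpace H₂ M₂] [IsManifold I₂ ∞ M₂]
  {f : M₁ → M₂}

lemma isSmoothAlong_smul (hf : ContMDiff I₁ I₂ ∞ f) {ρ : M₁ → ℝ} (hρ : ContMDiff I₁ 𝓘(ℝ, ℝ) ∞ ρ)
    {σ : ∀ p : M₁, TangentSpace I₂ (f p)} (hσ : IsSmoothAlong I₁ I₂ f σ) :
    IsSmoothAlong I₁ I₂ f (fun p ↦ ρ p • σ p) := by
  intro q
  have hy := mem_chart_source H₂ (f q)
  refine (contMDiffAt_along_iff hy).2 ⟨hf q, ?_⟩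
  simp only [map_smul]
  exact (hρ q).smul ((contMDiffAt_along_iff hy).1 (hσ q)).2

lemma isSmoothAlong_zero (hf : ContMDiff I₁ I₂ ∞ f) :
    IsSmoothAlong I₁ I₂ f (fun _ ↦ 0) := by
  intro q
  refine (contMDiffAt_along_iff (mem_chart_source H₂ (f q))).2 ⟨hf q, ?_⟩
  simp only [map_zero]
  exact contMDiffAt_const

variable [IsManifold I₁ ∞ M₁]
  [RiemannianBundle (fun x : M₁ ↦ TangentSpace I₁ x)]
  [RiemannianBundle (fun x : M₂ ↦ TangentSpace I₂ x)]
  [IsContMDiffRiemannianBundle I₁ ∞ (EuclideanSpace ℝ (Fin d)) (fun x : M₁ ↦ TangentSpace I₁ x)]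
  [IsContMDiffRiemannianBundle I₂ ∞ (EuclideanSpace ℝ (Fin d)) (fun x : M₂ ↦ TangentSpace I₂ x)]

lemma contDiffWithinAt_mul_fieldCoord {w : M₁ → ℝ} {Z : ∀ p : M₁, TangentSpace I₁ p} {p q : M₁}
    (hq : q ∈ (chartAt H₁ p).source) (hw : ContMDiffAt I₁ 𝓘(ℝ, ℝ) ∞ w q)
    (hZ : ContMDiffAt I₁ I₁.tangent ∞ (fun q ↦ (⟨q, Z q⟩ : TangentBundle I₁ M₁)) q) (i : Fin d) :
    ContDiffWithinAt ℝ ∞ (fun x ↦ w ((extChartAt I₁ p).symm x) * fieldCoord I₁ p Z x i)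
      (range I₁) (extChartAt I₁ p q) :=
  (contDiffWithinAt_comp_symm hq hw).mul
    (contDiffWithinAt_euclidean.1 (contDiffWithinAt_fieldCoord hq hZ) i)

variable (o₁ : ManifoldOrientation I₁ M₁) (o₂ : ManifoldOrientation I₂ M₂) [NeZero d]

/-- Additivity is taken from the divergence side of the pointwise formula, where σ enters through
the linear map (Cof df)^T. -/
lemma connectionInnerCof_sum (hf : ContMDiff I₁ I₂ ∞ f) {ι : Type*} (T : Finset ι)
    {σ : ι → ∀ p : M₁, TangentSpace I₂ (f p)} (hσ : ∀ k ∈ T, IsSmoothAlong I₁ I₂ f (σ k))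
    (hsum : IsSmoothAlong I₁ I₂ f (fun p ↦ ∑ k ∈ T, σ k p)) (q : M₁) :
    connectionInnerCof o₁ o₂ f (fun p ↦ ∑ k ∈ T, σ k p) q =
      ∑ k ∈ T, connectionInnerCof o₁ o₂ f (σ k) q := by
  have hq := mem_chart_source H₁ q
  refine mul_left_cancel₀ (coordVol_ne_zero o₁ hq) ?_
  rw [Finset.mul_sum, coordVol_mul_connectionInnerCof o₁ o₂ hf hsum hq,
    Finset.sum_congr rfl fun k hk ↦ coordVol_mul_connectionInnerCof o₁ o₂ hf (hσ k hk) hq,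
    Finset.sum_comm]
  refine Finset.sum_congr rfl fun i _ ↦ ?_
  have hd : ∀ k ∈ T, DifferentiableWithinAt ℝ (fun x ↦ coordVol o₁ q ((extChartAt I₁ q).symm x) *
      fieldCoord I₁ q (piolaAlong o₁ o₂ f (σ k)) x i) (range I₁) (extChartAt I₁ q q) := fun k hk ↦
    (contDiffWithinAt_mul_fieldCoord hq (contMDiffAt_coordVol o₁ hq)
      (contMDiff_piolaAlong o₁ o₂ hf (hσ k hk)).contMDiffAt i).differentiableWithinAt (by simp)
  have h := fderivWithin_fun_sum (uniqueDiffWithinAt_extChartAt q q) hd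
  have he : (fun x ↦ coordVol o₁ q ((extChartAt I₁ q).symm x) *
      fieldCoord I₁ q (piolaAlong o₁ o₂ f (fun p ↦ ∑ k ∈ T, σ k p)) x i) =
      fun x ↦ ∑ k ∈ T, coordVol o₁ q ((extChartAt I₁ q).symm x) *
        fieldCoord I₁ q (piolaAlong o₁ o₂ f (σ k)) x i := by
    ext x
    simp only [fieldCoord, piolaAlong, map_sum, WithLp.ofLp_sum, Finset.sum_apply, Finset.mul_sum]
  rw [he, h, sum_apply]

lemma connectionInnerCof_eq_zero (hf : ContMDiff I₁ I₂ ∞ f)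
    {σ : ∀ p : M₁, TangentSpace I₂ (f p)} (hσ : IsSmoothAlong I₁ I₂ f σ) {q : M₁}
    (hq : q ∉ closure {p | σ p ≠ 0}) : connectionInnerCof o₁ o₂ f σ q = 0 := by
  have hqs := mem_chart_source H₁ q
  refine mul_left_cancel₀ (coordVol_ne_zero o₁ hqs) ?_
  rw [coordVol_mul_connectionInnerCof o₁ o₂ hf hσ hqs, mul_zero]
  refine Finset.sum_eq_zero fun i _ ↦ ?_
  have hc : ContinuousAt (extChartAt I₁ q).symm (extChartAt I₁ q q) :=
    continuousAt_extChartAt_symm q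
  have he : (fun x ↦ coordVol o₁ q ((extChartAt I₁ q).symm x) *
      fieldCoord I₁ q (piolaAlong o₁ o₂ f σ) x i) =ᶠ[𝓝[range I₁] (extChartAt I₁ q q)]
      fun _ ↦ (0 : ℝ) := by
    have : (closure {p | σ p ≠ 0})ᶜ ∈ 𝓝 ((extChartAt I₁ q).symm (extChartAt I₁ q q)) := by
      rw [extChartAt_to_inv]
      exact isClosed_closure.isOpen_compl.mem_nhds hq
    filter_upwards [mem_nhdsWithin_of_mem_nhds (hc.preimage_mem_nhds this)] with x hx
    have h0 : σ ((extChartAt I₁ q).symm x) = 0 := by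
      by_contra h
      exact hx (subset_closure h)
    simp only [fieldCoord, piolaAlong, h0, map_zero, PiLp.zero_apply, mul_zero]
  rw [he.fderivWithin_eq_of_mem (extChartAt_mem_range q q)]
  simp

/-- The defining formula changes its chart from point to point; the divergence formula holds in one
fixed chart at all points near q and has smooth ingredients. -/
lemma continuous_connectionInnerCof (hf : ContMDiff I₁ I₂ ∞ f)
    {σ : ∀ p : M₁, TangentSpace I₂ (f p)} (hσ : IsSmoothAlong I₁ I₂ f σ) :
    Continuous (connectionInnerCof o₁ o₂ f σ) := by
  rw [continuous_iff_continuousAt]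
  intro q
  have hq := mem_chart_source H₁ q
  set h : Fin d → EuclideanSpace ℝ (Fin d) → ℝ := fun i x ↦
    coordVol o₁ q ((extChartAt I₁ q).symm x) * fieldCoord I₁ q (piolaAlong o₁ o₂ f σ) x i
  have he : connectionInnerCof o₁ o₂ f σ =ᶠ[𝓝 q] fun z ↦ (coordVol o₁ q z)⁻¹ *
      ∑ i, fderivWithin ℝ (h i) (range I₁) (extChartAt I₁ q z) (EuclideanSpace.single i 1) := by
    filter_upwards [(chartAt H₁ q).open_source.mem_nhds hq] with z hz
    rw [← coordVol_mul_connectionInnerCof o₁ o₂ hf hσ hz,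
      inv_mul_cancel_left₀ (coordVol_ne_zero o₁ hz)]
  refine ContinuousAt.congr ?_ he.symm
  refine ((contMDiffAt_coordVol o₁ hq).continuousAt.inv₀ (coordVol_ne_zero o₁ hq)).mul ?_
  refine tendsto_finsetSum _ fun i _ ↦ ?_
  have hc : ContDiffWithinAt ℝ ∞ (h i) (range I₁) (extChartAt I₁ q q) :=
    contDiffWithinAt_mul_fieldCoord hq (contMDiffAt_coordVol o₁ hq)
      (contMDiff_piolaAlong o₁ o₂ hf hσ).contMDiffAt i
  have hd : ContinuousWithinAt (fderivWithin ℝ (h i) (range I₁)) (range I₁) (extChartAt I₁ q q) :=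
    (hc.fderivWithin_right (m := 0) I₁.uniqueDiffOn (by simp)
      (extChartAt_mem_range q q)).continuousWithinAt
  have ht : Tendsto (extChartAt I₁ q) (𝓝 q) (𝓝[range I₁] (extChartAt I₁ q q)) :=
    tendsto_nhdsWithin_iff.2 ⟨continuousAt_extChartAt q,
      Eventually.of_forall fun z ↦ extChartAt_mem_range q z⟩
  exact ((ContinuousLinearMap.apply ℝ ℝ (EuclideanSpace.single i (1 : ℝ))).continuous.tendsto
    _).comp (hd.tendsto.comp ht)

/-- The coordinate divergence with respect to the Riemannian density. -/
lemma sqrt_gramDet_mul_connectionInnerCof (hf : ContMDiff I₁ I₂ ∞ f)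
    {σ : ∀ p : M₁, TangentSpace I₂ (f p)} (hσ : IsSmoothAlong I₁ I₂ f σ) {p q : M₁}
    (hq : q ∈ (chartAt H₁ p).source) :
    √(gramDet I₁ p q) * connectionInnerCof o₁ o₂ f σ q =
      ∑ i, fderivWithin ℝ (fun x ↦ √(gramDet I₁ p ((extChartAt I₁ p).symm x)) *
        fieldCoord I₁ p (piolaAlong o₁ o₂ f σ) x i) (range I₁) (extChartAt I₁ p q)
        (EuclideanSpace.single i 1) := by
  have hw := coordVol_ne_zero o₁ hq
  -- The volume uses the unsigned density and the pointwise formula the signed one. Near q they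
  -- differ by a constant sign, which passes through the derivative.
  obtain ⟨ε, hε⟩ : ∃ ε : ℝ, ∀ᶠ z in 𝓝 q, √(gramDet I₁ p z) = ε * coordVol o₁ p z := by
    have hc := (contMDiffAt_coordVol o₁ hq).continuousAt
    rcases lt_or_gt_of_ne hw with h | h
    · refine ⟨-1, ?_⟩
      filter_upwards [hc.eventually_lt_const h] with z hz
      rw [← coordVol_sq o₁, Real.sqrt_sq_eq_abs, abs_of_neg hz, neg_one_mul]
    · refine ⟨1, ?_⟩
      filter_upwards [hc.eventually_const_lt h] with z hz
      rw [← coordVol_sq o₁, Real.sqrt_sq_eq_abs, abs_of_pos hz, one_mul]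
  rw [hε.self_of_nhds, mul_assoc, coordVol_mul_connectionInnerCof o₁ o₂ hf hσ hq, Finset.mul_sum]
  refine Finset.sum_congr rfl fun i _ ↦ ?_
  have hc : ContinuousAt (extChartAt I₁ p).symm (extChartAt I₁ p q) :=
    continuousAt_extChartAt_symm' (by rwa [extChartAt_source])
  have he : (fun x ↦ √(gramDet I₁ p ((extChartAt I₁ p).symm x)) *
        fieldCoord I₁ p (piolaAlong o₁ o₂ f σ) x i) =ᶠ[𝓝[range I₁] (extChartAt I₁ p q)]
      fun x ↦ ε * (coordVol o₁ p ((extChartAt I₁ p).symm x) *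
        fieldCoord I₁ p (piolaAlong o₁ o₂ f σ) x i) := by
    have h2 : ∀ᶠ z in 𝓝 ((extChartAt I₁ p).symm (extChartAt I₁ p q)),
        √(gramDet I₁ p z) = ε * coordVol o₁ p z := by rwa [extChartAt_symm_apply hq]
    filter_upwards [(hc.eventually h2).filter_mono nhdsWithin_le_nhds] with x hx
    rw [hx, mul_assoc]
  rw [he.fderivWithin_eq_of_mem (extChartAt_mem_range p q), fderivWithin_const_mul
    (uniqueDiffWithinAt_extChartAt p q) ((contDiffWithinAt_mul_fieldCoord hq (contMDiffAt_coordVol o₁ hq)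
      (contMDiff_piolaAlong o₁ o₂ hf hσ).contMDiffAt i).differentiableWithinAt (by simp))]
  simp

/-- Integration by parts against the constant function 1. -/
lemma integral_fderiv_eq_zero {E : Type*} [NormedAddCommGroup E] [NormedSpace ℝ E]
    [FiniteDimensional ℝ E] [MeasurableSpace E] [BorelSpace E] (μ : Measure E) [μ.IsAddHaarMeasure]
    {h : E → ℝ} (hh : ContDiff ℝ 1 h) (hs : HasCompactSupport h) (v : E) :
    ∫ x, fderiv ℝ h x v ∂μ = 0 := by
  have hint : Integrable (fun x ↦ fderiv ℝ h x v) μ :=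
    ((hh.continuous_fderiv (by simp)).clm_apply continuous_const).integrable_of_hasCompactSupport
      ((hs.fderiv ℝ).comp_left (g := fun L : E →L[ℝ] ℝ ↦ L v) rfl)
  have := integral_mul_fderiv_eq_neg_fderiv_mul_of_integrable (μ := μ) (𝕜 := ℝ)
    (f := fun _ : E ↦ (1 : ℝ)) (g := h) (v := v) (by simp) (by simpa using hint)
    (by simpa using hh.continuous.integrable_of_hasCompactSupport hs) (by fun_prop)
    (fun x _ ↦ hh.differentiable (by simp) x)
  simpa using this

variable [T2Space M₁] [SecondCountableTopology M₁] [MeasurableSpace M₁] [BorelSpace M₁]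

/-- The integral of `⟨∇σ, Cof df⟩` vanishes for sections supported in one chart. -/
lemma integral_connectionInnerCof_of_chart (hf : ContMDiff I₁ I₂ ∞ f)
    {σ : ∀ p : M₁, TangentSpace I₂ (f p)} (hσ : IsSmoothAlong I₁ I₂ f σ)
    (hc : IsCompact (closure {p | σ p ≠ 0})) (hint : closure {p | σ p ≠ 0} ⊆ I₁.interior M₁)
    {p : M₁} (hp : closure {p | σ p ≠ 0} ⊆ (chartAt H₁ p).source) :
    ∫ q, connectionInnerCof o₁ o₂ f σ q ∂(riemannianVolume I₁ M₁) = 0 := by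
  rw [integral_riemannianVolume_of_chart p (continuous_connectionInnerCof o₁ o₂ hf hσ)
    fun q hq ↦ connectionInnerCof_eq_zero o₁ o₂ hf hσ fun h ↦ hq (hp h)]
  set e := extChartAt I₁ p
  set K := e '' closure {p | σ p ≠ 0} with hKdef
  have hK : IsCompact K := by
    refine hc.image_of_continuousOn ((continuousOn_extChartAt p).mono ?_)
    rwa [extChartAt_source]
  have hKT : K ⊆ e.target := by
    rintro _ ⟨q, hq, rfl⟩
    exact e.map_source (by rw [extChartAt_source]; exact hp hq)
  -- Support in the interior of M₁ puts K in the interior of the target; this is what excludes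
  -- boundary terms.
  have hKint : K ⊆ interior e.target := by
    rintro _ ⟨q, hq, rfl⟩
    exact (I₁.isInteriorPoint_iff_of_mem_atlas (n := ∞) (by simp) (chart_mem_atlas H₁ p)
      (hp hq)).1 (hint hq)
  have hσ0 : ∀ x ∈ e.target, x ∉ K → e.symm x ∉ closure {p | σ p ≠ 0} := fun x hx hxK h ↦
    hxK ⟨_, h, e.right_inv hx⟩
  set g : Fin d → EuclideanSpace ℝ (Fin d) → ℝ := fun i x ↦
    √(gramDet I₁ p (e.symm x)) * fieldCoord I₁ p (piolaAlong o₁ o₂ f σ) x i with hg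
  -- Extension by zero from the target to the whole model space; it is C¹ because it vanishes off
  -- the compact set K inside the interior of the target.
  set h : Fin d → EuclideanSpace ℝ (Fin d) → ℝ := fun i ↦ e.target.indicator (g i) with hh
  have hzero : ∀ i, ∀ x ∉ K, h i x = 0 := by
    intro i x hx
    by_cases hxt : x ∈ e.target
    · have h0 : σ (e.symm x) = 0 := by
        by_contra h'
        exact hσ0 x hxt hx (subset_closure h')
      have h1 : fieldCoord I₁ p (piolaAlong o₁ o₂ f σ) x = 0 := by
        rw [fieldCoord, piolaAlong]
        erw [h0]
        rw [map_zero, map_zero]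
      simp only [hh, indicator_of_mem hxt, hg, h1, PiLp.zero_apply, mul_zero]
    · simp only [hh, indicator_of_notMem hxt]
  have hcs : ∀ i, HasCompactSupport (h i) := fun i ↦ HasCompactSupport.intro hK (hzero i)
  have hnear : ∀ x ∈ K, e.target ∈ 𝓝 x :=
    fun x hx ↦ mem_interior_iff_mem_nhds.1 (hKint hx)
  have hrange : ∀ x ∈ K, range I₁ ∈ 𝓝 x := fun x hx ↦
    mem_of_superset (hnear x hx) (extChartAt_target_subset_range p)
  have hgK : ∀ i, ∀ x ∈ K, ContDiffAt ℝ ∞ (g i) x := by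
    intro i x hx
    have hxs := symm_mem_source (hKT hx)
    have hs : ContDiffAt ℝ ∞ Real.sqrt (gramDet I₁ p (e.symm x)) :=
      Real.contDiffAt_sqrt (gramDet_pos hxs).ne'
    have h1 := contDiffWithinAt_mul_fieldCoord hxs
      (hs.contMDiffAt.comp _ (contMDiffAt_gramDet hxs))
      (contMDiff_piolaAlong o₁ o₂ hf hσ).contMDiffAt i
    rw [e.right_inv (hKT hx)] at h1
    exact h1.contDiffAt (hrange x hx)
  have hgh : ∀ i, ∀ x ∈ K, h i =ᶠ[𝓝 x] g i := by
    intro i x hx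
    filter_upwards [hnear x hx] with y hy
    exact indicator_of_mem hy _
  have hsmooth : ∀ i, ContDiff ℝ 1 (h i) := by
    intro i
    rw [contDiff_iff_contDiffAt]
    intro x
    by_cases hx : x ∈ K
    · exact ((hgK i x hx).congr_of_eventuallyEq (hgh i x hx)).of_le ENat.LEInfty.out
    · refine (contDiffAt_const (c := (0 : ℝ))).congr_of_eventuallyEq ?_
      filter_upwards [hK.isClosed.isOpen_compl.mem_nhds hx] with y hy
      exact hzero i y hy
  have hpt : ∀ x, e.target.indicator (fun x ↦ √(gramDet I₁ p (e.symm x)) *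
      connectionInnerCof o₁ o₂ f σ (e.symm x)) x =
      ∑ i, fderiv ℝ (h i) x (EuclideanSpace.single i 1) := by
    intro x
    by_cases hx : x ∈ K
    · have hm := sqrt_gramDet_mul_connectionInnerCof o₁ o₂ hf hσ (symm_mem_source (hKT hx))
      rw [e.right_inv (hKT hx)] at hm
      rw [indicator_of_mem (hKT hx), hm]
      refine Finset.sum_congr rfl fun i _ ↦ ?_
      rw [(hgh i x hx).fderiv_eq, fderivWithin_of_mem_nhds (hrange x hx)]
    · have h1 : ∀ i, fderiv ℝ (h i) x = 0 := by
        intro i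
        have : h i =ᶠ[𝓝 x] fun _ ↦ 0 := by
          filter_upwards [hK.isClosed.isOpen_compl.mem_nhds hx] with y hy
          exact hzero i y hy
        rw [this.fderiv_eq, fderiv_fun_const]
        rfl
      simp only [h1, zero_apply, Finset.sum_const_zero]
      by_cases hxt : x ∈ e.target
      · rw [indicator_of_mem hxt, connectionInnerCof_eq_zero o₁ o₂ hf hσ (hσ0 x hxt hx), mul_zero]
      · rw [indicator_of_notMem hxt]
  rw [← integral_indicator (measurableSet_extChartAt_target p), integral_congr_ae (ae_of_all _ hpt),
    integral_finsetSum]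
  · exact Finset.sum_eq_zero fun i _ ↦ integral_fderiv_eq_zero volume (hsmooth i) (hcs i) _
  · intro i _
    exact (((hsmooth i).continuous_fderiv (by simp)).clm_apply
      continuous_const).integrable_of_hasCompactSupport
      (((hcs i).fderiv ℝ).comp_left (g := fun L : EuclideanSpace ℝ (Fin d) →L[ℝ] ℝ ↦
        L (EuclideanSpace.single i 1)) rfl)

/-- The cofactor of the differential is weakly coclosed. -/
theorem integral_connectionInnerCof (hf : ContMDiff I₁ I₂ ∞ f)
    {σ : ∀ p : M₁, TangentSpace I₂ (f p)} (hσ : IsSmoothAlong I₁ I₂ f σ)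
    (hc : IsCompact (closure {p | σ p ≠ 0})) (hint : closure {p | σ p ≠ 0} ⊆ I₁.interior M₁) :
    ∫ q, connectionInnerCof o₁ o₂ f σ q ∂(riemannianVolume I₁ M₁) = 0 := by
  have : LocallyCompactSpace H₁ := I₁.locallyCompactSpace
  have : LocallyCompactSpace M₁ := ChartedSpace.locallyCompactSpace H₁ M₁
  have := isLocallyFiniteMeasure_riemannianVolume (I := I₁) (M := M₁)
  obtain ⟨ρ, hρ⟩ := SmoothPartitionOfUnity.exists_isSubordinate_chartAt_source I₁ M₁
  -- Finitely many cutoffs meet the compact support, so σ is a finite sum of sections each supported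
  -- in one chart. Additivity in σ is enough; no derivative of a cutoff is computed.
  have hfin := ρ.locallyFinite.finite_nonempty_inter_compact hc
  set T := hfin.toFinset
  set τ : M₁ → ∀ p : M₁, TangentSpace I₂ (f p) := fun k p ↦ ρ k p • σ p
  have hτ : ∀ k, IsSmoothAlong I₁ I₂ f (τ k) := fun k ↦
    isSmoothAlong_smul hf (ρ k).contMDiff hσ
  have hsum : σ = fun p ↦ ∑ k ∈ T, τ k p := by
    ext1 p
    by_cases h0 : σ p = 0
    · simp [τ, h0]
    have hp : p ∈ closure {p | σ p ≠ 0} := subset_closure h0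
    have h1 : ∑ k ∈ T, ρ k p = 1 := by
      rw [← ρ.sum_eq_one (mem_univ p), finsum_eq_sum_of_support_subset]
      intro k hk
      rw [Finset.mem_coe, Set.Finite.mem_toFinset]
      exact ⟨p, hk, hp⟩
    simp only [τ, ← Finset.sum_smul, h1, one_smul]
  have hsub : ∀ k, closure {p | τ k p ≠ 0} ⊆ closure {p | σ p ≠ 0} := fun k ↦
    closure_mono fun p hp h0 ↦ hp (by simp [τ, h0])
  have hsub' : ∀ k, closure {p | τ k p ≠ 0} ⊆ (chartAt H₁ k).source := fun k ↦
    (show closure {p | τ k p ≠ 0} ⊆ tsupport (ρ k) from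
      closure_mono fun p hp h0 ↦ hp (by simp [τ, h0])).trans (hρ k)
  have hcomp : ∀ k, IsCompact (closure {p | τ k p ≠ 0}) := fun k ↦
    hc.of_isClosed_subset isClosed_closure (hsub k)
  have hF : ∀ q, connectionInnerCof o₁ o₂ f σ q =
      ∑ k ∈ T, connectionInnerCof o₁ o₂ f (τ k) q := by
    intro q
    have hσ' := hσ
    rw [hsum] at hσ'
    conv_lhs => rw [hsum]
    exact connectionInnerCof_sum o₁ o₂ hf T (fun k _ ↦ hτ k) hσ' q
  simp only [hF]
  rw [integral_finsetSum]
  · exact Finset.sum_eq_zero fun k _ ↦ integral_connectionInnerCof_of_chart o₁ o₂ hf (hτ k)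
      (hcomp k) ((hsub k).trans hint) (hsub' k)
  · intro k _
    exact (continuous_connectionInnerCof o₁ o₂ hf (hτ k)).integrable_of_hasCompactSupport
      (HasCompactSupport.intro (hcomp k) fun q hq ↦ connectionInnerCof_eq_zero o₁ o₂ hf (hτ k) hq)

end Coclosed

/-! ### Uniqueness of the coderivative -/

section Uniqueness

variable {d : ℕ}
  {H₁ : Type*} [TopologicalSpace H₁] {I₁ : ModelWithCorners ℝ (EuclideanSpace ℝ (Fin d)) H₁}
  {M₁ : Type*} [TopologicalSpace M₁] [ChartedSpace H₁ M₁] [IsManifold I₁ ∞ M₁]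
  {H₂ : Type*} [TopologicalSpace H₂] {I₂ : ModelWithCorners ℝ (EuclideanSpace ℝ (Fin d)) H₂}
  {M₂ : Type*} [TopologicalSpace M₂] [ChartedSpace H₂ M₂] [IsManifold I₂ ∞ M₂]
  {f : M₁ → M₂}

variable (I₁) in
-- Test sections see only the interior; density lets continuity carry the vanishing of a section to
-- the boundary.
lemma dense_interior : Dense (I₁.interior M₁) := by
  intro p
  rw [mem_closure_iff]
  intro U hU hpU
  have hmem : (extChartAt I₁ p).target ∩ (extChartAt I₁ p).symm ⁻¹' U ∈
      𝓝[range I₁] (extChartAt I₁ p p) := by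
    refine inter_mem (extChartAt_target_mem_nhdsWithin p) (mem_nhdsWithin_of_mem_nhds ?_)
    refine (continuousAt_extChartAt_symm (I := I₁) p).preimage_mem_nhds (hU.mem_nhds ?_)
    rwa [extChartAt_to_inv]
  obtain ⟨V, hV, hxV, hVS⟩ := mem_nhdsWithin.1 hmem
  obtain ⟨x, hxV, hx⟩ := mem_closure_iff.1
    (I₁.range_subset_closure_interior (extChartAt_mem_range (I := I₁) p p)) V hV hxV
  obtain ⟨hxt, hxU⟩ := hVS ⟨hxV, interior_subset hx⟩
  refine ⟨(extChartAt I₁ p).symm x, hxU, ?_⟩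
  refine (I₁.isInteriorPoint_iff_of_mem_atlas (n := ∞) (by simp) (chart_mem_atlas H₁ p)
    (symm_mem_source hxt)).2 ?_
  have hr : (chartAt H₁ p).extend I₁ ((extChartAt I₁ p).symm x) = x :=
    (extChartAt I₁ p).right_inv hxt
  rw [hr]
  exact mem_interior.2 ⟨V ∩ interior (range I₁),
    fun y hy ↦ (hVS ⟨hy.1, interior_subset hy.2⟩).1, hV.inter isOpen_interior, hxV, hx⟩

variable [RiemannianBundle (fun x : M₁ ↦ TangentSpace I₁ x)]
  [RiemannianBundle (fun x : M₂ ↦ TangentSpace I₂ x)]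
  [IsContMDiffRiemannianBundle I₁ ∞ (EuclideanSpace ℝ (Fin d)) (fun x : M₁ ↦ TangentSpace I₁ x)]
  [IsContMDiffRiemannianBundle I₂ ∞ (EuclideanSpace ℝ (Fin d)) (fun x : M₂ ↦ TangentSpace I₂ x)]
  [T2Space M₁] [SecondCountableTopology M₁] [MeasurableSpace M₁] [BorelSpace M₁]

/-- A smooth section which is orthogonal to all test sections vanishes. -/
lemma eq_zero_of_integral_inner_eq_zero (hf : ContMDiff I₁ I₂ ∞ f)
    {η : ∀ p : M₁, TangentSpace I₂ (f p)} (hη : IsSmoothAlong I₁ I₂ f η)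
    (h : ∀ σ : ∀ p : M₁, TangentSpace I₂ (f p), IsSmoothAlong I₁ I₂ f σ →
      IsCompact (closure {p | σ p ≠ 0}) → closure {p | σ p ≠ 0} ⊆ I₁.interior M₁ →
      ∫ p, inner ℝ (σ p) (η p) ∂(riemannianVolume I₁ M₁) = 0) (p : M₁) : η p = 0 := by
  have := isLocallyFiniteMeasure_riemannianVolume (I := I₁) (M := M₁)
  have := isOpenPosMeasure_riemannianVolume (I := I₁) (M := M₁)
  have hcont : Continuous fun p ↦ (inner ℝ (η p) (η p) : ℝ) :=
    (ContMDiff.inner_bundle (IB := I₂) (F := EuclideanSpace ℝ (Fin d))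
      (E := fun x : M₂ ↦ TangentSpace I₂ x) (b := f) hη hη).continuous
  have hinterior : ∀ q ∈ I₁.interior M₁, (inner ℝ (η q) (η q) : ℝ) = 0 := by
    intro q hq
    by_contra hne
    have hopen : IsOpen (I₁.interior M₁) := I₁.isOpen_interior (n := ∞) (by simp)
    -- The test section is φ η with φ a bump at q supported in the interior. If η q ≠ 0, the
    -- integral of φ ⟨η, η⟩ is positive, since the integrand is continuous and nonnegative and the
    -- volume charges open sets.
    obtain ⟨φ, -, hφ⟩ := (SmoothBumpFunction.nhds_basis_tsupport (I := I₁) q).mem_iff.1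
      (hopen.mem_nhds hq)
    have hsub : closure {p | φ p • η p ≠ 0} ⊆ tsupport φ :=
      closure_mono fun p hp h0 ↦ hp (by rw [h0, zero_smul])
    have h0 := h (fun p ↦ φ p • η p) (isSmoothAlong_smul hf φ.contMDiff hη)
      (φ.hasCompactSupport.of_isClosed_subset isClosed_closure hsub) (hsub.trans hφ)
    simp only [real_inner_smul_left] at h0
    have hpos := (φ.continuous.mul hcont).integral_pos_of_hasCompactSupport_nonneg_nonzero
      (μ := riemannianVolume I₁ M₁) φ.hasCompactSupport.mul_right
      (fun p ↦ mul_nonneg φ.nonneg real_inner_self_nonneg) (x := q) (by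
        rw [Pi.mul_apply, φ.eq_one, one_mul]; exact hne)
    exact hpos.ne' h0
  have hall : (fun p ↦ (inner ℝ (η p) (η p) : ℝ)) = fun _ ↦ 0 :=
    hcont.ext_on (dense_interior I₁) continuous_const hinterior
  exact inner_self_eq_zero.1 (congrFun hall p)

end Uniqueness

end Piola

end

theorem mainTheorem2 {d : ℕ} [NeZero d]
    {H₁ : Type*} [TopologicalSpace H₁] (I₁ : ModelWithCorners ℝ (EuclideanSpace ℝ (Fin d)) H₁)
    {M₁ : Type*} [TopologicalSpace M₁] [T2Space M₁] [SecondCountableTopology M₁]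
    [ChartedSpace H₁ M₁] [IsManifold I₁ ∞ M₁]
    [RiemannianBundle (fun x : M₁ ↦ TangentSpace I₁ x)]
    [IsContMDiffRiemannianBundle I₁ ∞ (EuclideanSpace ℝ (Fin d)) (fun x : M₁ ↦ TangentSpace I₁ x)]
    [MeasurableSpace M₁] [BorelSpace M₁]
    {H₂ : Type*} [TopologicalSpace H₂] (I₂ : ModelWithCorners ℝ (EuclideanSpace ℝ (Fin d)) H₂)
    {M₂ : Type*} [TopologicalSpace M₂] [T2Space M₂] [SecondCountableTopology M₂]
    [ChartedSpace H₂ M₂] [IsManifold I₂ ∞ M₂]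
    [RiemannianBundle (fun x : M₂ ↦ TangentSpace I₂ x)]
    [IsContMDiffRiemannianBundle I₂ ∞ (EuclideanSpace ℝ (Fin d)) (fun x : M₂ ↦ TangentSpace I₂ x)]
    (o₁ : Piola.ManifoldOrientation I₁ M₁) (o₂ : Piola.ManifoldOrientation I₂ M₂)
    (f : M₁ → M₂) (hf : ContMDiff I₁ I₂ ∞ f) :
    ∃ δ : ∀ p : M₁, TangentSpace I₂ (f p),
      Piola.IsCoderivative I₁ I₂ f (Piola.cofDifferential o₁ o₂ f) δ ∧
      (∀ δ' : ∀ p : M₁, TangentSpace I₂ (f p),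
        Piola.IsCoderivative I₁ I₂ f (Piola.cofDifferential o₁ o₂ f) δ' → δ' = δ) ∧
      ∀ X : ∀ y : M₂, TangentSpace I₂ y,
        ContMDiff I₂ I₂.tangent ∞ (fun y ↦ (⟨y, X y⟩ : TangentBundle I₂ M₂)) →
        ContMDiff I₁ I₁.tangent ∞
          (fun p ↦ (⟨p, Piola.piola o₁ o₂ f X p⟩ : TangentBundle I₁ M₁)) ∧
        ∀ p : M₁,
          Piola.divergence I₁ (Piola.piola o₁ o₂ f X) p =
            Piola.divergence I₂ X (f p) * Piola.detDifferential o₁ o₂ f p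
              - inner ℝ (X (f p)) (δ p) := by
  -- The zero section works: the right-hand side of the adjoint equation vanishes for all test
  -- sections. The same vanishing makes any other coderivative orthogonal to all of them.
  refine ⟨fun _ ↦ 0, ⟨Piola.isSmoothAlong_zero hf, fun σ hσ hc hint ↦ ?_⟩,
    fun δ' hδ' ↦ funext (Piola.eq_zero_of_integral_inner_eq_zero hf hδ'.smooth
      fun σ hσ hc hint ↦ ?_), fun X hX ↦ ⟨?_, fun p ↦ ?_⟩⟩
  · simp only [inner_zero_right, integral_zero]
    exact (Piola.integral_connectionInnerCof o₁ o₂ hf hσ hc hint).symm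
  · rw [hδ'.adjoint σ hσ hc hint]
    exact Piola.integral_connectionInnerCof o₁ o₂ hf hσ hc hint
  · exact Piola.contMDiff_piolaAlong o₁ o₂ hf (Piola.isSmoothAlong_comp hf hX)
  · rw [Piola.divergence_piola o₁ o₂ hf hX, inner_zero_right, sub_zero]
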